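/- Let $M$ be a Hausdorff smooth $n$-dimensional manifold (without boundary), let $\nabla$ be a smooth affine connection on $M$, and let $D$ be a smooth distribution of rank $p$ on $M$, i.e. a smooth rank-$p$ subbundle of $TM$. Say that $D$ is \emph{geodesically invariant} if for every geodesic $c:[a,b]\to M$ of $\nabla$ (a smooth curve with $\nabla_{\dot c}\dot c=0$), $\dot c(a)\in D_{c(a)}$ implies $\dot c(t)\in D_{c(t)}$ for all $t\in[a,b]$. Let $Z$ be the geodesic spray of $\nabla$, i.e. the vector field on $TM$ whose value at $v\in TM$ is the $\nabla$-horizontal lift of $v$ to $T_vTM$; in induced coordinates $(x^i,v^i)$ on $TM$, $$Z=v^i\frac{\partial}{\partial x^i}-\Gamma^i_{jk}v^jv^k\frac{\partial}{\partial v^i}.$$ Then $D$ is geodesically invariant if and only if $Z$ is tangent to $D$, regarded as a submanifold of $TM$; that is, if and only if $Z(v)\in T_vD$ for every $v\in D$. -/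

import Mathlib

open Set Bundle
open scoped Manifold ContDiff Topology

noncomputable section

namespace GeodesicInvariance

variable {E : Type*} [NormedAddCommGroup E] [NormedSpace ℝ E]
  {H : Type*} [TopologicalSpace H] {I : ModelWithCorners ℝ E H}
  {M : Type*} [TopologicalSpace M] [ChartedSpace H M]

/-! ### Geodesics of an affine connection -/

/-- The velocity `ċ(t)` of a curve `c` defined on `s ⊆ ℝ` (one-sided at the end points of an
interval). -/
def velocity (c : ℝ → M) (s : Set ℝ) (t : ℝ) : TangentSpace I (c t) :=
  mfderivWithin 𝓘(ℝ, ℝ) I c s t (1 : ℝ)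

variable [IsManifold I 1 M]

/-- The covariant derivative `(∇_ċ V)(t)` of a vector field `V` along a curve `c` defined on
`s ⊆ ℝ`. In the frame `(e_i)` of `TM` near `c t` given by the preferred trivialization at `c t`,
writing `V r = ∑ i, V^i(r) e_i(c r)`, it is `∑ i, (V^i)'(t) e_i(c t) + V^i(t) ∇_{ċ(t)} e_i`;
here `FiberBundle.extend E (V t)` is the local vector field `∑ i, V^i(t) e_i`. -/
def covDerivAlong (cov : CovariantDerivative I E (TangentSpace I : M → Type _))
    (c : ℝ → M) (s : Set ℝ) (V : (t : ℝ) → TangentSpace I (c t)) (t : ℝ) :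
    TangentSpace I (c t) :=
  (trivializationAt E (TangentSpace I : M → Type _) (c t)).symm (c t)
      (derivWithin (fun r ↦ (trivializationAt E (TangentSpace I : M → Type _) (c t)
        (⟨c r, V r⟩ : TangentBundle I M)).2) s t)
    + cov (FiberBundle.extend E (V t)) (c t) (velocity c s t)

/-- `c` is a (smooth) geodesic on `s ⊆ ℝ`: `∇_ċ ċ = 0` along `c`. -/
structure IsGeodesicOn (cov : CovariantDerivative I E (TangentSpace I : M → Type _))
    (c : ℝ → M) (s : Set ℝ) : Prop where
  contMDiffOn : ContMDiffOn 𝓘(ℝ, ℝ) I ∞ c s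
  covDerivAlong_velocity : ∀ t ∈ s, covDerivAlong cov c s (velocity c s) t = 0

/-! ### Distributions and geodesic invariance -/

/-- `D` is a smooth distribution of rank `p` on `M`: locally it is spanned by `p` smooth pointwise
linearly independent vector fields. -/
def IsSmoothDistribution (D : (x : M) → Submodule ℝ (TangentSpace I x)) (p : ℕ) : Prop :=
  ∀ x₀ : M, ∃ U : Set M, IsOpen U ∧ x₀ ∈ U ∧
    ∃ X : Fin p → (x : M) → TangentSpace I x,
      (∀ i, ContMDiffOn I I.tangent ∞ (fun x ↦ (⟨x, X i x⟩ : TangentBundle I M)) U) ∧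
      ∀ x ∈ U, LinearIndependent ℝ (fun i ↦ X i x) ∧
        D x = Submodule.span ℝ (range fun i ↦ X i x)

/-- A geodesic `c : [a, b] → M` with `ċ(a) ∈ D` has `ċ(t) ∈ D` for all `t ∈ [a, b]`. -/
def GeodesicallyInvariant (cov : CovariantDerivative I E (TangentSpace I : M → Type _))
    (D : (x : M) → Submodule ℝ (TangentSpace I x)) : Prop :=
  ∀ (a b : ℝ) (c : ℝ → M), a < b → IsGeodesicOn cov c (Icc a b) →
    velocity c (Icc a b) a ∈ D (c a) →
    ∀ t ∈ Icc a b, velocity c (Icc a b) t ∈ D (c t)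

/-- The distribution `D` as a subset of the tangent bundle. -/
def totalSet (D : (x : M) → Submodule ℝ (TangentSpace I x)) : Set (TangentBundle I M) :=
  {v | v.2 ∈ D v.proj}

/-! ### The geodesic spray -/

/-- The vertical lift of `w ∈ T_x M` at `v ∈ T_x M`: the velocity at `0` of `t ↦ v + t w`. -/
def verticalLift (v : TangentBundle I M) (w : TangentSpace I v.proj) :
    TangentSpace I.tangent v :=
  mfderiv 𝓘(ℝ, ℝ) I.tangent
    (fun t : ℝ ↦ (⟨v.proj, v.2 + t • w⟩ : TangentBundle I M)) 0 (1 : ℝ)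

/-- The horizontal lift to `T_v TM` of `w ∈ T_x M`, `x = π(v)`: for a vector field `X` near `x`
with `X(x) = v` it is `T_x X (w) - vlft_v (∇_w X)`, so that it equals `T_x X (w)` as soon as
`∇_w X = 0`. The choice of `X` is immaterial, see `horizontalLift_eq` below. -/
def horizontalLift (cov : CovariantDerivative I E (TangentSpace I : M → Type _))
    (v : TangentBundle I M) (w : TangentSpace I v.proj) : TangentSpace I.tangent v :=
  letI dX : TangentSpace I.tangent v := mfderiv I I.tangent
    (fun y ↦ (⟨y, FiberBundle.extend E v.2 y⟩ : TangentBundle I M)) v.proj w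
  dX - verticalLift v (cov (FiberBundle.extend E v.2) v.proj w)

/-- The geodesic spray of `∇`, a vector field on `TM`: `Z(v)` is the horizontal lift of `v` to
`T_v TM`, that is, the velocity of the parallel transport of `v` in the direction `v`. In induced
coordinates `Z = v^i ∂/∂x^i - Γ^i_{jk} v^j v^k ∂/∂v^i`. -/
def geodesicSpray (cov : CovariantDerivative I E (TangentSpace I : M → Type _))
    (v : TangentBundle I M) : TangentSpace I.tangent v :=
  horizontalLift cov v v.2

/-! ### Tangency to a subset -/

/-- The tangent vectors at `v` to an (embedded) submanifold `S` of `TM`: the velocities at `0` of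
smooth curves `(-ε, ε) → TM` through `v` that lie in `S`. -/
def tangentVectors (S : Set (TangentBundle I M)) (v : TangentBundle I M) :
    Set (TangentSpace I.tangent v) :=
  {ζ | ∃ (ε : ℝ) (γ : ℝ → TangentBundle I M), 0 < ε ∧ γ 0 = v ∧
    ContMDiffOn 𝓘(ℝ, ℝ) I.tangent ∞ γ (Ioo (-ε) ε) ∧ (∀ t ∈ Ioo (-ε) ε, γ t ∈ S) ∧
    (mfderiv 𝓘(ℝ, ℝ) I.tangent γ 0 (1 : ℝ) : TangentSpace I.tangent (γ 0)) = ζ}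

/-- The vector field `Z` on `TM` is tangent to the submanifold `S` of `TM`. -/
def IsTangentTo (Z : (v : TangentBundle I M) → TangentSpace I.tangent v)
    (S : Set (TangentBundle I M)) : Prop :=
  ∀ v ∈ S, Z v ∈ tangentVectors S v

/-! ### The definitions do not depend on the choices made in them -/

section
variable {E' : Type*} [NormedAddCommGroup E'] [NormedSpace ℝ E']
  {H' : Type*} [TopologicalSpace H'] {I' : ModelWithCorners ℝ E' H'}
  {N : Type*} [TopologicalSpace N] [ChartedSpace H' N] 

lemma triv_self (x : M) (u : TangentSpace I x) :
   (trivializationAt E (TangentSpace I : M → Type _) x (⟨x, u⟩ : TangentBundle I M)).2 = u := by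
  exact (tangentBundleCore I M).coordChange_self _ _ (mem_chart_source H x) _

lemma mfderiv_totalSpace {f : N → TangentBundle I M} {x₀ : N}
    (hf : MDifferentiableAt I' I.tangent f x₀) (w : TangentSpace I' x₀) :
    (mfderiv I' I.tangent f x₀ w : E × E) =
      ((mfderiv I' I (fun y ↦ (f y).proj) x₀ w : E),
       (mfderiv I' 𝓘(ℝ, E) (fun y ↦ (trivializationAt E (TangentSpace I : M → Type _)
          (f x₀).proj (f y)).2) x₀ w : E)) := by
  have h2 := (mdifferentiableAt_totalSpace I f).1 hf
  have h1 : ∀ᶠ y in 𝓝 x₀, (f y).proj ∈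
      (trivializationAt E (TangentSpace I : M → Type _) (f x₀).proj).baseSet :=
    ((FiberBundle.continuous_proj E (TangentSpace I)).continuousAt.comp hf.continuousAt)
      ((Trivialization.open_baseSet _).mem_nhds (FiberBundle.mem_baseSet_trivializationAt E _ _))
  rw [hf.mfderiv, h2.1.mfderiv, h2.2.mfderiv]
  have hx : extChartAt I' x₀ x₀ ∈ range I' := mem_range_self _
  have hu : UniqueDiffWithinAt ℝ (range I') (extChartAt I' x₀ x₀) := I'.uniqueDiffOn _ hx
  have key : writtenInExtChartAt I' I.tangent x₀ f =ᶠ[𝓝[range I'] (extChartAt I' x₀ x₀)]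
      fun z ↦ (writtenInExtChartAt I' I x₀ (fun y ↦ (f y).proj) z,
        writtenInExtChartAt I' 𝓘(ℝ, E) x₀ (fun y ↦ (trivializationAt E (TangentSpace I : M → Type _)
          (f x₀).proj (f y)).2) z) := by
    have := (continuousAt_extChartAt_symm (I := I') x₀).continuousWithinAt (s := range I')
    rw [ContinuousWithinAt, extChartAt_to_inv] at this
    filter_upwards [this.eventually h1] with z hz
    simp only [writtenInExtChartAt, FiberBundle.extChartAt, Function.comp_apply,
      PartialEquiv.trans_apply, PartialEquiv.prod_coe, PartialEquiv.refl_coe]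
    simp only [OpenPartialHomeomorph.coe_toPartialEquiv, Trivialization.coe_coe]
    rw [Trivialization.coe_fst' _ hz]
    rfl
  rw [key.fderivWithin_eq_of_mem hx,
    DifferentiableWithinAt.fderivWithin_prodMk h2.1.differentiableWithinAt_writtenInExtChartAt
      h2.2.differentiableWithinAt_writtenInExtChartAt hu]
  rfl

lemma verticalLift_eq (x : M) (a b : E) :
    (verticalLift (⟨x, a⟩ : TangentBundle I M) b : E × E) = ((0 : E), b) := by
  have e1 : ∀ t : ℝ, (trivializationAt E (TangentSpace I : M → Type _) x
      (⟨x, (a + t • b : E)⟩ : TangentBundle I M)).2 = (a + t • b : E) := fun t ↦ triv_self _ _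
  have hd : HasDerivAt (fun t : ℝ ↦ a + t • b) b 0 := by
    simpa using ((hasDerivAt_id (0 : ℝ)).smul_const b).const_add a
  have hf : MDifferentiableAt 𝓘(ℝ, ℝ) I.tangent
      (fun t : ℝ ↦ (⟨x, (a + t • b : E)⟩ : TangentBundle I M)) 0 := by
    rw [mdifferentiableAt_totalSpace]
    refine ⟨mdifferentiableAt_const, ?_⟩
    simp only [e1]
    exact hd.differentiableAt.mdifferentiableAt
  have := mfderiv_totalSpace hf (1 : ℝ)
  refine this.trans (Prod.ext ?_ ?_)
  · simp only [mfderiv_const]; rfl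
  · simp only [mfderiv_eq_fderiv]
    have h3 : HasFDerivAt (fun t : ℝ ↦ (trivializationAt E (TangentSpace I : M → Type _) x
      (⟨x, (a + t • b : E)⟩ : TangentBundle I M)).2) _ 0 :=
        hd.hasFDerivAt.congr_of_eventuallyEq (.of_forall e1)
    refine (DFunLike.congr_fun h3.fderiv (1 : ℝ)).trans ?_
    exact one_smul ℝ b

/-- The derivative at `x` of a vector field, read in the preferred trivialization at `x`. -/
def secDeriv (X : (y : M) → TangentSpace I y) (x : M) : E →L[ℝ] E :=
  mfderiv I 𝓘(ℝ, E) (fun y ↦ (trivializationAt E (TangentSpace I : M → Type _) x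
        (⟨y, X y⟩ : TangentBundle I M)).2) x

/-- `∇X` at `x`, as a map on the model space. -/
def covE (cov : CovariantDerivative I E (TangentSpace I : M → Type _))
    (X : (y : M) → TangentSpace I y) (x : M) : E →L[ℝ] E := cov X x

lemma mfderiv_section {X : (y : M) → TangentSpace I y} {x : M}
    (hX : MDifferentiableAt I I.tangent (fun y ↦ (⟨y, X y⟩ : TangentBundle I M)) x) (w : E) :
    (mfderiv I I.tangent (fun y ↦ (⟨y, X y⟩ : TangentBundle I M)) x w : E × E) =
      (w, secDeriv X x w) := by
  refine (mfderiv_totalSpace hX w).trans (Prod.ext ?_ rfl)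
  exact DFunLike.congr_fun (mfderiv_id (I := I) (x := x)) w

lemma horizontalLift_self (cov : CovariantDerivative I E (TangentSpace I : M → Type _))
    (x : M) (a w : E) :
    (horizontalLift cov (⟨x, a⟩ : TangentBundle I M) w : E × E) =
      (w, secDeriv (FiberBundle.extend E (show TangentSpace I x from a)) x w
         - covE cov (FiberBundle.extend E (show TangentSpace I x from a)) x w) := by
  have h0 := FiberBundle.mdifferentiableAt_extend (V := (TangentSpace I : M → Type _)) I E
    (show TangentSpace I x from a)
  have b2 := verticalLift_eq (I := I) x a (cov (FiberBundle.extend E (show TangentSpace I x from a)) x w)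
  unfold horizontalLift
  refine (congrArg₂ (fun p q : E × E ↦ p - q) (mfderiv_section h0 w) b2).trans ?_
  exact Prod.ext (sub_zero _) rfl

/-- The part of the derivative of a section seen in the preferred trivialization differs from the
covariant derivative by a tensor. -/
lemma tensorialAt_sub (cov : CovariantDerivative I E (TangentSpace I : M → Type _)) (x : M)
    (w : E) :
    TensorialAt I E (fun X : (y : M) → TangentSpace I y ↦ secDeriv X x w - covE cov X x w) x where
  smul {f σ} hf hσ := by
    have hσ' := (mdifferentiableAt_section I σ).1 hσ
    have h1 : covE cov (f • σ) x w = f x • covE cov σ x w + HSMul.hSMul (α := ℝ) (β := E) (mfderiv I 𝓘(ℝ, ℝ) f x w) (σ x) :=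
      DFunLike.congr_fun (cov.isCovariantDerivativeOnUniv.leibniz hσ hf) w
    have h2 : secDeriv (f • σ) x w = f x • secDeriv σ x w + HSMul.hSMul (α := ℝ) (β := E) (mfderiv I 𝓘(ℝ, ℝ) f x w) (σ x) := by
      have this : HasMFDerivAt I 𝓘(ℝ, E) (fun y ↦ f y •
          (trivializationAt E (TangentSpace I : M → Type _) x (⟨y, σ y⟩ : TangentBundle I M)).2) x _ :=
        ⟨hf.hasMFDerivAt.1.smul hσ'.hasMFDerivAt.1, hf.hasMFDerivAt.2.smul hσ'.hasMFDerivAt.2⟩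
      have h3 : (fun y ↦ (trivializationAt E (TangentSpace I : M → Type _) x
        (⟨y, (f • σ) y⟩ : TangentBundle I M)).2) =ᶠ[𝓝 x] (fun y ↦ f y • (trivializationAt E (TangentSpace I : M → Type _) x
        (⟨y, σ y⟩ : TangentBundle I M)).2) := by
        filter_upwards [(trivializationAt E (TangentSpace I : M → Type _) x).open_baseSet.mem_nhds
          (FiberBundle.mem_baseSet_trivializationAt E _ x)] with y hy
        exact ((trivializationAt E (TangentSpace I : M → Type _) x).linear ℝ hy).map_smul _ _
      have h4 := (this.congr_of_eventuallyEq h3).mfderiv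
      refine (DFunLike.congr_fun h4 w).trans ?_
      have hi := extChartAt_to_inv (I := I) x
      exact congrArg₂ (fun (r : ℝ) (z : E) ↦ r • secDeriv σ x w +
          HSMul.hSMul (α := ℝ) (β := E) (mfderiv I 𝓘(ℝ, ℝ) f x w) z) (congrArg f hi)
        ((congrArg (fun y ↦ (trivializationAt E (TangentSpace I : M → Type _) x
          (⟨y, σ y⟩ : TangentBundle I M)).2) hi).trans (triv_self x (σ x)))
    simp only [h1, h2]
    module
  add {σ σ'} hσ hσ' := by
    have hs := (mdifferentiableAt_section I σ).1 hσ
    have hs' := (mdifferentiableAt_section I σ').1 hσ'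
    have h1 : covE cov (σ + σ') x w = covE cov σ x w + covE cov σ' x w :=
      DFunLike.congr_fun (cov.isCovariantDerivativeOnUniv.add hσ hσ') w
    have h2 : secDeriv (σ + σ') x w = secDeriv σ x w + secDeriv σ' x w := by
      have := hs.hasMFDerivAt.add hs'.hasMFDerivAt
      have h3 : (fun y ↦ (trivializationAt E (TangentSpace I : M → Type _) x
        (⟨y, (σ + σ') y⟩ : TangentBundle I M)).2) =ᶠ[𝓝 x] (fun y ↦ (trivializationAt E (TangentSpace I : M → Type _) x
        (⟨y, σ y⟩ : TangentBundle I M)).2) + (fun y ↦ (trivializationAt E (TangentSpace I : M → Type _) x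
        (⟨y, σ' y⟩ : TangentBundle I M)).2) := by
        filter_upwards [(trivializationAt E (TangentSpace I : M → Type _) x).open_baseSet.mem_nhds
          (FiberBundle.mem_baseSet_trivializationAt E _ x)] with y hy
        exact ((trivializationAt E (TangentSpace I : M → Type _) x).linear ℝ hy).map_add _ _
      have h4 := (this.congr_of_eventuallyEq h3).mfderiv
      exact (DFunLike.congr_fun h4 w)
    simp only [h1, h2]
    module

lemma triv_symm_self (x : M) (u : E) :
   (trivializationAt E (TangentSpace I : M → Type _) x).symm x u = (u : E) := by
  have := (trivializationAt E (TangentSpace I : M → Type _) x).symm_apply_apply_mk (FiberBundle.mem_baseSet_trivializationAt' x) (show TangentSpace I x from u)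
  rw [triv_self] at this
  exact this

lemma triv_extend (x : M) (u : TangentSpace I x) (y : M)
    (hy : y ∈ (trivializationAt E (TangentSpace I : M → Type _) x).baseSet) :
    (trivializationAt E (TangentSpace I : M → Type _) x
      (⟨y, FiberBundle.extend E u y⟩ : TangentBundle I M)).2 = u := by
  have h := (trivializationAt E (TangentSpace I : M → Type _) x).apply_mk_symm hy
    ((trivializationAt E (TangentSpace I : M → Type _) x (⟨x, u⟩ : TangentBundle I M)).2)
  exact (congrArg Prod.snd h).trans (triv_self x u)

variable [FiniteDimensional ℝ E] [IsManifold I 2 M]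

/-- The horizontal lift is `T_x X (w) - vlft (∇_w X)` for every vector field `X` through the given
point that is differentiable there. -/
lemma horizontalLift_eq (cov : CovariantDerivative I E (TangentSpace I : M → Type _))
    (x : M) (X : (y : M) → TangentSpace I y)
    (hX : MDifferentiableAt I I.tangent (fun y ↦ (⟨y, X y⟩ : TangentBundle I M)) x)
    (w : TangentSpace I x) :
    horizontalLift cov ⟨x, X x⟩ w =
      mfderiv I I.tangent (fun y ↦ (⟨y, X y⟩ : TangentBundle I M)) x w
        - verticalLift ⟨x, X x⟩ (cov X x w) := by
  have h0 := FiberBundle.mdifferentiableAt_extend (V := (TangentSpace I : M → Type _)) I E (X x)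
  have hp := (tensorialAt_sub cov x w).pointwise h0 hX
    (FiberBundle.extend_apply_self ..)
  have b1 := verticalLift_eq (I := I) x (X x) (cov X x w)
  refine (horizontalLift_self cov x (X x) w).trans ?_
  refine Eq.trans ?_ (congrArg₂ (fun p q : E × E ↦ p - q) (mfderiv_section hX w) b1).symm
  exact Prod.ext (sub_zero _).symm hp


/-- If `X(x) = v` and `∇_v X = 0`, then `Z(v) = T_x X (v)`. With `X = ∑ i, ξ^i s_i` for a frame
`(s_i)` parallel at `x` in the direction `v`, this is the description of the spray through standard
horizontal vector fields on the frame bundle. -/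
lemma geodesicSpray_eq_of_parallel (cov : CovariantDerivative I E (TangentSpace I : M → Type _))
    (x : M) (X : (y : M) → TangentSpace I y)
    (hX : MDifferentiableAt I I.tangent (fun y ↦ (⟨y, X y⟩ : TangentBundle I M)) x)
    (hpar : cov X x (X x) = 0) :
    geodesicSpray cov ⟨x, X x⟩ =
      mfderiv I I.tangent (fun y ↦ (⟨y, X y⟩ : TangentBundle I M)) x (X x) := by
  have h : (verticalLift (⟨x, X x⟩ : TangentBundle I M) (0 : E) : E × E) = 0 :=
    verticalLift_eq (I := I) x (X x) 0
  refine (horizontalLift_eq cov x X hX (X x)).trans ?_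
  rw [hpar]
  exact (congrArg (fun q : E × E ↦ (_ : E × E) - q) h).trans (sub_zero _)

/-- If `V = X ∘ c` for a vector field `X` on `M`, then `∇_ċ V = ∇_ċ X`. -/
lemma covDerivAlong_comp (cov : CovariantDerivative I E (TangentSpace I : M → Type _))
    (c : ℝ → M) (s : Set ℝ) (t : ℝ) (hs : UniqueDiffWithinAt ℝ s t) (X : (y : M) → TangentSpace I y)
    (hc : MDifferentiableWithinAt 𝓘(ℝ, ℝ) I c s t)
    (hX : MDifferentiableAt I I.tangent (fun y ↦ (⟨y, X y⟩ : TangentBundle I M)) (c t)) :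
    covDerivAlong cov c s (fun r ↦ X (c r)) t = cov X (c t) (velocity c s t) := by
  have h0 := FiberBundle.mdifferentiableAt_extend (V := (TangentSpace I : M → Type _)) I E (X (c t))
  have hp := (tensorialAt_sub cov (c t) (velocity (I := I) c s t)).pointwise h0 hX
    (FiberBundle.extend_apply_self ..)
  have hz : secDeriv (FiberBundle.extend E (X (c t))) (c t) (velocity (I := I) c s t) = (0 : E) := by
    have h3 : (fun y ↦ (trivializationAt E (TangentSpace I : M → Type _) (c t)
        (⟨y, FiberBundle.extend E (X (c t)) y⟩ : TangentBundle I M)).2) =ᶠ[𝓝 (c t)] fun y ↦ (X (c t) : E) := by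
        filter_upwards [(trivializationAt E (TangentSpace I : M → Type _) (c t)).open_baseSet.mem_nhds
          (FiberBundle.mem_baseSet_trivializationAt E _ (c t))] with y hy
        exact triv_extend (c t) (X (c t)) y hy
    unfold secDeriv
    have h4 : HasMFDerivAt I 𝓘(ℝ, E) (fun y ↦ (trivializationAt E (TangentSpace I : M → Type _) (c t)
        (⟨y, FiberBundle.extend E (X (c t)) y⟩ : TangentBundle I M)).2) (c t) (0 : E →L[ℝ] E) :=
      (hasMFDerivAt_const (I := I) (I' := 𝓘(ℝ, E)) (M' := E) (X (c t)) (c t)).congr_of_eventuallyEq h3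
    exact DFunLike.congr_fun h4.mfderiv _
  have hX' := (mdifferentiableAt_section I X).1 hX
  have h6 : derivWithin (fun r ↦ (trivializationAt E (TangentSpace I : M → Type _) (c t)
        (⟨c r, X (c r)⟩ : TangentBundle I M)).2) s t = secDeriv X (c t) (velocity (I := I) c s t) := by
    unfold secDeriv velocity
    generalize hg : (fun y ↦ (trivializationAt E (TangentSpace I : M → Type _) (c t)
        (⟨y, X y⟩ : TangentBundle I M)).2) = g at hX' ⊢
    have hg' : (fun r ↦ (trivializationAt E (TangentSpace I : M → Type _) (c t)
        (⟨c r, X (c r)⟩ : TangentBundle I M)).2) = g ∘ c := by rw [← hg]; rfl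
    rw [hg']
    have := HasMFDerivAt.comp_hasMFDerivWithinAt t hX'.hasMFDerivAt hc.hasMFDerivWithinAt
    let A : E →L[ℝ] E := mfderiv I 𝓘(ℝ, E) g (c t)
    let B : ℝ →L[ℝ] E := mfderivWithin 𝓘(ℝ, ℝ) I c s t
    have h5 : HasFDerivWithinAt (g ∘ c) (A.comp B) s t := hasMFDerivWithinAt_iff_hasFDerivWithinAt.1 this
    rw [← fderivWithin_derivWithin]
    exact DFunLike.congr_fun (h5.fderivWithin hs) (1:ℝ)
  unfold covDerivAlong
  rw [h6]
  refine (congrArg (fun z : E ↦ z + covE cov (FiberBundle.extend E (X (c t))) (c t) (velocity (I := I) c s t)) (triv_symm_self (c t) _)).trans ?_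
  simp only [hz] at hp
  have : ∀ a b d : E, 0 - b = a - d → a + b = d := by
    intro a b d h
    have := congrArg (fun z ↦ z + b + d) h
    simp only [zero_sub] at this
    rw [show a + b = a - d + b + d by abel, ← h]; abel
  exact this _ _ _ hp
end

end GeodesicInvariance
end

/-! In the coordinates $(x,v)$ of $TM$ induced by a chart, the spray is $Z=(v,-\Gamma(x)(v,v))$, and
velocity curves of geodesics are its integral curves. A smooth distribution is locally $\{(x,v):
A(x)v=0\}$ for a smooth family of projections $A(x)$ (`IsSmoothDistribution.exists_projection`). The
derivative of $A(x)v$ along $Z$ at $(x,w)$ is $Q_x(w,w)$, where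
$Q_x(y,w)=(DA(x)y)w-A(x)\Gamma(x)(y,w)$ is bilinear. Tangency of $Z$ to $D$ makes $Q_x(w,w)$ vanish
for $w\in\ker A(x)$ (`fderiv_apply_sub_eq_zero_of_mem_tangentVectors`).

Tangency implies invariance: along a geodesic, $u=A(x)v$ satisfies $u'=Q_x(v,v)$. Since $v-u\in\ker
A(x)$, bilinearity leaves only terms containing a factor $u$, so $|u'|\le K|u|$ on a compact
interval, and $u(a)=0$ forces $u=0$ by Grönwall (`apply_eq_zero_of_geodesicEquation`). This avoids
integral curves inside $D$ and uniqueness arguments for them. The result is local in a chart; a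
closedness and continuation argument spreads it over $[a,b]$.

Invariance implies tangency: through $v\in D$ there is a geodesic on some
$(-\varepsilon,\varepsilon)$ with velocity $v$ at $0$. Its velocity curve stays in $D$, for positive
times by invariance and for negative times by reversing the geodesic, and the derivative of that
curve at $0$ is $Z(v)$. -/

noncomputable section

namespace GeodesicInvariance

/-! ### Analysis in a vector space: the geodesic equation and families of projections. -/

section Calculus

variable {E : Type*} [NormedAddCommGroup E] [NormedSpace ℝ E]

/-- Local existence of smooth solutions of the second order equation `x'' = -Γ(x)(x', x')`. -/
lemma exists_geodesicEquation_solution [CompleteSpace E] {O : Set E} (hO : IsOpen O)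
    {Γ : E → E →L[ℝ] E →L[ℝ] E} (hΓ : ContDiffOn ℝ ∞ Γ O) {z : E} (hz : z ∈ O) (u : E) :
    ∃ ε > (0 : ℝ), ∃ x v : ℝ → E, x 0 = z ∧ v 0 = u ∧
      ContDiffOn ℝ ∞ x (Ioo (-ε) ε) ∧ ContDiffOn ℝ ∞ v (Ioo (-ε) ε) ∧
      ∀ t ∈ Ioo (-ε) ε, x t ∈ O ∧ HasDerivAt x (v t) t ∧
        HasDerivAt v (-(Γ (x t) (v t) (v t))) t := by
  let f : E × E → E × E := fun q ↦ (q.2, -(Γ q.1 q.2 q.2))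
  have hΓ' : ContDiffOn ℝ ∞ (fun q : E × E ↦ Γ q.1) (O ×ˢ univ) :=
    hΓ.comp contDiff_fst.contDiffOn fun q hq ↦ hq.1
  have hf : ContDiffOn ℝ ∞ f (O ×ˢ univ) :=
    contDiff_snd.contDiffOn.prodMk
      (((hΓ'.clm_apply contDiff_snd.contDiffOn).clm_apply contDiff_snd.contDiffOn).neg)
  have hOu : IsOpen (O ×ˢ (univ : Set E)) := hO.prod isOpen_univ
  have hz' : (z, u) ∈ O ×ˢ (univ : Set E) := ⟨hz, mem_univ _⟩
  obtain ⟨α, hα0, ε, hε, hα⟩ :=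
    ((hf.contDiffAt (hOu.mem_nhds hz')).of_le (by norm_cast) :
      ContDiffAt ℝ 1 f (z, u)).exists_forall_mem_closedBall_exists_eq_forall_mem_Ioo_hasDerivAt₀ 0
  have hcont : ContinuousAt α 0 := (hα 0 (by simp [hε])).continuousAt
  have hmem : ∀ᶠ t in 𝓝 (0 : ℝ), α t ∈ O ×ˢ (univ : Set E) :=
    hcont.eventually (by rw [hα0]; exact hOu.mem_nhds hz')
  obtain ⟨δ, hδ, hδm⟩ := Metric.eventually_nhds_iff.1 hmem
  -- Halving makes the closed interval $[-r,r]$ fit inside both open ones; the regularity result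
  -- below is stated on closed intervals.
  have hr : 0 < min ε δ / 2 := by positivity
  have hrε : min ε δ / 2 < ε := by linarith [min_le_left ε δ, lt_min hε hδ]
  have hrδ : min ε δ / 2 < δ := by linarith [min_le_right ε δ, lt_min hε hδ]
  set r := min ε δ / 2
  have hd : ∀ t ∈ Icc (-r) r, HasDerivAt α (f (α t)) t := fun t ht ↦
    hα t ⟨by linarith [ht.1], by linarith [ht.2]⟩
  have hm : MapsTo α (Icc (-r) r) (O ×ˢ (univ : Set E)) := fun t ht ↦ hδm (by
    rw [Real.dist_eq, sub_zero, abs_lt]; exact ⟨by linarith [ht.1], by linarith [ht.2]⟩)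
  -- The existence theorem gives differentiability only; smoothness is bootstrapped from that of the
  -- field `f`.
  have hsm : ContDiffOn ℝ ∞ α (Icc (-r) r) :=
    ODE.contDiffOn_enat_Icc_of_hasDerivWithinAt (f := fun _ ↦ f) (n := ⊤)
      (hf.comp contDiff_snd.contDiffOn fun q hq ↦ hq.2) (fun t ht ↦ (hd t ht).hasDerivWithinAt) hm
  refine ⟨r, hr, fun t ↦ (α t).1, fun t ↦ (α t).2, by simp [hα0], by simp [hα0],
    (contDiff_fst.comp_contDiffOn hsm).mono Ioo_subset_Icc_self,
    (contDiff_snd.comp_contDiffOn hsm).mono Ioo_subset_Icc_self, fun t ht ↦ ?_⟩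
  have ht' := Ioo_subset_Icc_self ht
  exact ⟨(hm ht').1, (hd t ht').fst, (hd t ht').snd⟩

lemma continuousOn_opNorm {X F G : Type*} [TopologicalSpace X] [NormedAddCommGroup F]
    [NormedSpace ℝ F] [NormedAddCommGroup G] [NormedSpace ℝ G] {f : X → F →L[ℝ] G} {s : Set X}
    (hf : ContinuousOn f s) : ContinuousOn (fun t ↦ ‖f t‖) s :=
  hf.norm

/-- If `ker A` is invariant under the second order equation to first order, then a solution of the
equation that starts in `ker A` stays there. -/
lemma apply_eq_zero_of_geodesicEquation {O : Set E} (hO : IsOpen O)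
    {Γ : E → E →L[ℝ] E →L[ℝ] E} (hΓ : ContinuousOn Γ O)
    {A : E → E →L[ℝ] E} (hA : ContDiffOn ℝ 1 A O)
    (hidem : ∀ z ∈ O, ∀ w, A z (A z w) = A z w)
    (htan : ∀ z ∈ O, ∀ w, A z w = 0 → fderiv ℝ A z w w - A z (Γ z w w) = 0)
    {a b : ℝ} {x v : ℝ → E} (hx : ∀ t ∈ Icc a b, x t ∈ O)
    (hx' : ∀ t ∈ Icc a b, HasDerivWithinAt x (v t) (Icc a b) t)
    (hv' : ∀ t ∈ Icc a b, HasDerivWithinAt v (-(Γ (x t) (v t) (v t))) (Icc a b) t)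
    (h0 : A (x a) (v a) = 0) : ∀ t ∈ Icc a b, A (x t) (v t) = 0 := by
  have hxc : ContinuousOn x (Icc a b) := fun t ht ↦ (hx' t ht).continuousWithinAt
  have hvc : ContinuousOn v (Icc a b) := fun t ht ↦ (hv' t ht).continuousWithinAt
  have hAc : ContinuousOn (fun t ↦ A (x t)) (Icc a b) := hA.continuousOn.comp hxc hx
  have hDc : ContinuousOn (fun t ↦ fderiv ℝ A (x t)) (Icc a b) :=
    (hA.continuousOn_fderiv_of_isOpen hO le_rfl).comp hxc hx
  have hΓc : ContinuousOn (fun t ↦ Γ (x t)) (Icc a b) := hΓ.comp hxc hx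
  let u : ℝ → E := fun t ↦ A (x t) (v t)
  have huc : ContinuousOn u (Icc a b) := hAc.clm_apply hvc
  -- On the diagonal, `Q t w w` is the derivative of $A(x)v$ along the spray at `(x t, w)`; as a
  -- bilinear form it can be estimated off the diagonal.
  let Q : ℝ → E → E → E := fun t y w ↦ fderiv ℝ A (x t) y w - A (x t) (Γ (x t) y w)
  have hu' : ∀ t ∈ Icc a b, HasDerivWithinAt u (Q t (v t) (v t)) (Icc a b) t := by
    intro t ht
    have h1 : HasDerivWithinAt (fun t ↦ A (x t)) (fderiv ℝ A (x t) (v t)) (Icc a b) t :=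
      ((hA.differentiableOn one_ne_zero).differentiableAt
        (hO.mem_nhds (hx t ht))).hasFDerivAt.comp_hasDerivWithinAt t (hx' t ht)
    have := h1.clm_apply (hv' t ht)
    rw [map_neg, ← sub_eq_add_neg] at this
    exact this
  let q : ℝ → ℝ := fun t ↦ (‖fderiv ℝ A (x t)‖ + ‖A (x t)‖ * ‖Γ (x t)‖) * (‖v t‖ + ‖v t - u t‖)
  have hDn : ContinuousOn (fun t ↦ ‖fderiv ℝ A (x t)‖) (Icc a b) :=
    continuousOn_opNorm hDc
  have hΓn : ContinuousOn (fun t ↦ ‖Γ (x t)‖) (Icc a b) := continuousOn_opNorm hΓc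
  have hqc : ContinuousOn q (Icc a b) :=
    (hDn.add (hAc.norm.mul hΓn)).mul (hvc.norm.add (hvc.sub huc).norm)
  obtain ⟨K, hK⟩ := isCompact_Icc.bddAbove_image hqc
  have hQ : ∀ t y w, ‖Q t y w‖ ≤ (‖fderiv ℝ A (x t)‖ + ‖A (x t)‖ * ‖Γ (x t)‖) * (‖y‖ * ‖w‖) := by
    intro t y w
    calc ‖Q t y w‖ ≤ ‖fderiv ℝ A (x t) y w‖ + ‖A (x t) (Γ (x t) y w)‖ := norm_sub_le _ _
      _ ≤ ‖fderiv ℝ A (x t)‖ * ‖y‖ * ‖w‖ + ‖A (x t)‖ * (‖Γ (x t)‖ * ‖y‖ * ‖w‖) := by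
        gcongr
        · exact ContinuousLinearMap.le_opNorm₂ _ _ _
        · exact ((A (x t)).le_opNorm _).trans
            (by gcongr; exact ContinuousLinearMap.le_opNorm₂ _ _ _)
      _ = _ := by ring
  have hbound : ∀ t ∈ Icc a b, ‖Q t (v t) (v t)‖ ≤ K * ‖u t‖ := by
    intro t ht
    -- `v - u` is $(1-A)v$, which lies in the kernel of $A$ by idempotence.
    have hker : Q t (v t - u t) (v t - u t) = 0 :=
      htan _ (hx t ht) _ (by simp [u, hidem _ (hx t ht)])
    -- The order of the arguments is kept, since $\Gamma$ need not be symmetric: the connection may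
    -- have torsion.
    have hsplit : Q t (v t) (v t) = Q t (u t) (v t) + Q t (v t - u t) (u t) := by
      have : Q t (v t) (v t) = Q t (u t) (v t) + Q t (v t - u t) (u t)
          + Q t (v t - u t) (v t - u t) := by
        simp only [Q, map_sub, sub_apply]
        abel
      rw [this, hker, add_zero]
    calc ‖Q t (v t) (v t)‖ ≤ ‖Q t (u t) (v t)‖ + ‖Q t (v t - u t) (u t)‖ := by
          rw [hsplit]; exact norm_add_le _ _
      _ ≤ _ := add_le_add (hQ _ _ _) (hQ _ _ _)
      _ = q t * ‖u t‖ := by simp only [q]; ring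
      _ ≤ K * ‖u t‖ := by gcongr; exact hK (mem_image_of_mem q ht)
  refine eq_zero_of_abs_deriv_le_mul_abs_self_of_eq_zero_right huc (fun t ht ↦ ?_) h0
    fun t ht ↦ hbound t (Ico_subset_Icc_self ht)
  exact (hu' t (Ico_subset_Icc_self ht)).mono_of_mem_nhdsWithin
    (Icc_mem_nhdsGE_of_mem ht)

/-- A smooth family of subspaces is locally the kernel of a smooth family of projections. -/
lemma exists_contDiffOn_projection [FiniteDimensional ℝ E] {O : Set E} (hO : IsOpen O) {p : ℕ}
    {ξ : Fin p → E → E} (hξ : ∀ i, ContDiffOn ℝ ∞ (ξ i) O) {z₀ : E} (hz₀ : z₀ ∈ O)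
    (hli : LinearIndependent ℝ fun i ↦ ξ i z₀) :
    ∃ O' ⊆ O, IsOpen O' ∧ z₀ ∈ O' ∧ ∃ A : E → E →L[ℝ] E, ContDiffOn ℝ ∞ A O' ∧
      ∀ z ∈ O', (∀ w, A z (A z w) = A z w) ∧
        ∀ w, A z w = 0 ↔ w ∈ Submodule.span ℝ (range fun i ↦ ξ i z) := by
  let b : E → (Fin p → ℝ) →L[ℝ] E := fun z ↦
    ∑ i, (ContinuousLinearMap.proj (R := ℝ) (φ := fun _ : Fin p ↦ ℝ) i).smulRight (ξ i z)
  have hbapp : ∀ z a, b z a = ∑ i, a i • ξ i z := fun z a ↦ by simp [b]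
  have hb : ContDiffOn ℝ ∞ b O := by
    rw [contDiffOn_clm_apply]
    intro a
    simp only [hbapp]
    exact ContDiffOn.sum fun i _ ↦ contDiffOn_const.smul (hξ i)
  have hrange : ∀ z w, w ∈ Submodule.span ℝ (range fun i ↦ ξ i z) ↔ ∃ a, b z a = w := by
    intro z w
    simp only [hbapp]
    exact Submodule.mem_span_range_iff_exists_fun ℝ
  have hinj : LinearMap.ker (b z₀ : (Fin p → ℝ) →ₗ[ℝ] E) = ⊥ := by
    rw [LinearMap.ker_eq_bot']
    intro a ha
    have : ∑ i, a i • ξ i z₀ = 0 := by rw [← hbapp]; exact ha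
    exact funext (Fintype.linearIndependent_iff.1 hli a this)
  -- A left inverse $L$ of $b(z_0)$ makes $S(z)=L\,b(z)$ equal to the identity at $z_0$, hence
  -- invertible nearby. Then $P=b\,S^{-1}L$ satisfies $Pb=b$, so it projects onto the image of
  -- $b(z)$, which is the span; $A=1-P$ has that span as kernel.
  obtain ⟨L₀, hL₀⟩ := LinearMap.exists_leftInverse_of_injective _ hinj
  let L : E →L[ℝ] (Fin p → ℝ) := LinearMap.toContinuousLinearMap L₀
  let S : E → (Fin p → ℝ) →L[ℝ] (Fin p → ℝ) := fun z ↦ L ∘L b z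
  have hS : ContDiffOn ℝ ∞ S O := contDiffOn_const.clm_comp hb
  have hS0 : S z₀ = 1 := by
    ext1 a
    exact LinearMap.congr_fun hL₀ a
  let O' : Set E := O ∩ S ⁻¹' {T | IsUnit T}
  have hO' : IsOpen O' := hS.continuousOn.isOpen_inter_preimage hO Units.isOpen
  let P : E → E →L[ℝ] E := fun z ↦ b z ∘L Ring.inverse (S z) ∘L L
  have hinv : ContDiffOn ℝ ∞ (fun z ↦ Ring.inverse (S z)) O' := by
    intro z hz
    obtain ⟨T, hT⟩ := hz.2
    have h1 : ContDiffAt ℝ ∞ Ring.inverse (S z) := hT ▸ contDiffAt_ringInverse ℝ T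
    exact h1.comp_contDiffWithinAt z ((hS z hz.1).mono inter_subset_left)
  refine ⟨O', inter_subset_left, hO', ⟨hz₀, by simp [hS0]⟩, fun z ↦ 1 - P z,
    contDiffOn_const.sub ((hb.mono inter_subset_left).clm_comp (hinv.clm_comp contDiffOn_const)),
    fun z hz ↦ ?_⟩
  have hPb : ∀ a, P z (b z a) = b z a := by
    intro a
    have : (Ring.inverse (S z) * S z) a = a := by rw [Ring.inverse_mul_cancel _ hz.2]; rfl
    exact congrArg (b z) this
  have hPP : ∀ w, P z (P z w) = P z w := fun w ↦ hPb _
  refine ⟨fun w ↦ by simp [hPP], fun w ↦ ?_⟩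
  rw [hrange]
  constructor
  · intro h
    exact ⟨Ring.inverse (S z) (L w), (sub_eq_zero.1 h).symm⟩
  · rintro ⟨a, rfl⟩
    simp [hPb]

end Calculus

/-! ### Fibre coordinates on $TM$ and the splitting of its tangent vectors. -/

section Coordinates

variable {E : Type*} [NormedAddCommGroup E] [NormedSpace ℝ E]
  {M : Type*} [TopologicalSpace M] [ChartedSpace E M] [IsManifold 𝓘(ℝ, E) ∞ M]

/-- The fibre coordinate `(v^i)` on `TM` induced by the preferred chart at `x₀`. -/
def fiberCoord (x₀ : M) (v : TangentBundle 𝓘(ℝ, E) M) : E :=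
  (trivializationAt E (TangentSpace 𝓘(ℝ, E) : M → Type _) x₀ v).2

/-- The local vector field with constant coefficients `u` in the preferred chart at `x₀`. -/
def constField (x₀ : M) (u : E) (y : M) : TangentSpace 𝓘(ℝ, E) y :=
  (trivializationAt E (TangentSpace 𝓘(ℝ, E) : M → Type _) x₀).symm y u

variable {x₀ y : M}

lemma fiberCoord_constField (hy : y ∈ (chartAt E x₀).source) (u : E) :
    fiberCoord x₀ ⟨y, constField x₀ u y⟩ = u :=
  congrArg Prod.snd ((trivializationAt E (TangentSpace 𝓘(ℝ, E) : M → Type _) x₀).apply_mk_symm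
    hy u)

lemma constField_fiberCoord (hy : y ∈ (chartAt E x₀).source) (w : TangentSpace 𝓘(ℝ, E) y) :
    constField x₀ (fiberCoord x₀ ⟨y, w⟩) y = w :=
  (trivializationAt E (TangentSpace 𝓘(ℝ, E) : M → Type _) x₀).symm_apply_apply_mk hy w

lemma constField_linear (hy : y ∈ (chartAt E x₀).source) :
    IsLinearMap ℝ fun u : E ↦ constField x₀ u y := by
  have h := (trivializationAt E (TangentSpace 𝓘(ℝ, E) : M → Type _) x₀).coe_symmₗ (R := ℝ) hy
  unfold constField
  rw [← h]
  exact LinearMap.isLinear _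

lemma fiberCoord_linear (hy : y ∈ (chartAt E x₀).source) :
    IsLinearMap ℝ fun w : TangentSpace 𝓘(ℝ, E) y ↦ fiberCoord x₀ ⟨y, w⟩ :=
  (trivializationAt E (TangentSpace 𝓘(ℝ, E) : M → Type _) x₀).linear ℝ hy

/-- The fibre coordinates as a linear map on the tangent space at `y`. -/
def fiberCoordₗ (hy : y ∈ (chartAt E x₀).source) : TangentSpace 𝓘(ℝ, E) y →ₗ[ℝ] E :=
  (fiberCoord_linear hy).mk' _

lemma fiberCoord_inj (hy : y ∈ (chartAt E x₀).source) {w w' : TangentSpace 𝓘(ℝ, E) y}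
    (h : fiberCoord x₀ ⟨y, w⟩ = fiberCoord x₀ ⟨y, w'⟩) : w = w' := by
  rw [← constField_fiberCoord hy w, h, constField_fiberCoord hy]

lemma contMDiffAt_fiberCoord {v : TangentBundle 𝓘(ℝ, E) M}
    (hv : v.proj ∈ (chartAt E x₀).source) :
    ContMDiffAt 𝓘(ℝ, E).tangent 𝓘(ℝ, E) ∞ (fiberCoord x₀) v := by
  have h := (Trivialization.contMDiffAt_iff (IM := 𝓘(ℝ, E).tangent) (IB := 𝓘(ℝ, E)) (n := ∞)
    (e := trivializationAt E (TangentSpace 𝓘(ℝ, E) : M → Type _) x₀) (f := id) (x₀ := v)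
    ((Trivialization.mem_source _).2 hv)).1 contMDiffAt_id
  exact h.2

lemma _root_.ContMDiffWithinAt.fiberCoord {F N : Type*} [NormedAddCommGroup F] [NormedSpace ℝ F]
    [TopologicalSpace N] [ChartedSpace F N] {f : N → TangentBundle 𝓘(ℝ, E) M} {s : Set N} {a : N}
    (hf : ContMDiffWithinAt 𝓘(ℝ, F) 𝓘(ℝ, E).tangent ∞ f s a)
    (ha : (f a).proj ∈ (chartAt E x₀).source) :
    ContMDiffWithinAt 𝓘(ℝ, F) 𝓘(ℝ, E) ∞ (fun t ↦ GeodesicInvariance.fiberCoord x₀ (f t)) s a :=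
  (contMDiffAt_fiberCoord ha).comp_contMDiffWithinAt a hf

lemma contMDiffOn_constField (x₀ : M) (u : E) :
    ContMDiffOn 𝓘(ℝ, E) 𝓘(ℝ, E).tangent ∞
      (fun y ↦ (⟨y, constField x₀ u y⟩ : TangentBundle 𝓘(ℝ, E) M)) (chartAt E x₀).source := by
  refine ((trivializationAt E (TangentSpace 𝓘(ℝ, E) : M → Type _)
    x₀).contMDiffOn_section_baseSet_iff).2 ?_
  exact (contMDiffOn_const (c := u)).congr fun y hy ↦ fiberCoord_constField hy u

lemma mdifferentiableAt_constField (hy : y ∈ (chartAt E x₀).source) (u : E) :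
    MDifferentiableAt 𝓘(ℝ, E) 𝓘(ℝ, E).tangent
      (fun y ↦ (⟨y, constField x₀ u y⟩ : TangentBundle 𝓘(ℝ, E) M)) y :=
  ((contMDiffOn_constField x₀ u).contMDiffAt
    ((chartAt E x₀).open_source.mem_nhds hy)).mdifferentiableAt (by simp)

/-- The splitting of `T_v TM` in the preferred chart at `π(v)`. -/
lemma mfderiv_proj_fiberCoord (v : TangentBundle 𝓘(ℝ, E) M) (ζ : E × E) :
    ζ = ((mfderiv 𝓘(ℝ, E).tangent 𝓘(ℝ, E)
          (fun w : TangentBundle 𝓘(ℝ, E) M ↦ w.proj) v ζ : E),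
        (mfderiv 𝓘(ℝ, E).tangent 𝓘(ℝ, E) (fiberCoord v.proj) v ζ : E)) := by
  have h := mfderiv_totalSpace (I' := 𝓘(ℝ, E).tangent) (I := 𝓘(ℝ, E)) (f := id)
    (x₀ := v) mdifferentiableAt_id ζ
  exact (DFunLike.congr_fun (mfderiv_id (I := 𝓘(ℝ, E).tangent) (x := v)) ζ).symm.trans h

/-- The velocity of a curve in `TM`, in terms of its base curve and its fibre coordinates. -/
lemma derivWithin_fiberCoord {γ : ℝ → TangentBundle 𝓘(ℝ, E) M} {s : Set ℝ} {t : ℝ}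
    (hs : UniqueDiffWithinAt ℝ s t) (hγ : MDifferentiableWithinAt 𝓘(ℝ, ℝ) 𝓘(ℝ, E).tangent γ s t)
    (hx : (γ t).proj ∈ (chartAt E x₀).source) :
    (mfderiv 𝓘(ℝ, E).tangent 𝓘(ℝ, E) (fiberCoord x₀) (γ t)
      (mfderivWithin 𝓘(ℝ, ℝ) 𝓘(ℝ, E).tangent γ s t (1 : ℝ)) : E) =
        derivWithin (fun r ↦ fiberCoord x₀ (γ r)) s t := by
  have h := mfderiv_comp_mfderivWithin t
    ((contMDiffAt_fiberCoord hx).mdifferentiableAt (by simp)) hγ hs.uniqueMDiffWithinAt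
  rw [mfderivWithin_eq_fderivWithin] at h
  rw [← fderivWithin_derivWithin]
  exact (DFunLike.congr_fun h (1 : ℝ)).symm

lemma mfderivWithin_curve {γ : ℝ → TangentBundle 𝓘(ℝ, E) M} {s : Set ℝ} {t : ℝ}
    (hs : UniqueDiffWithinAt ℝ s t)
    (hγ : MDifferentiableWithinAt 𝓘(ℝ, ℝ) 𝓘(ℝ, E).tangent γ s t) :
    (mfderivWithin 𝓘(ℝ, ℝ) 𝓘(ℝ, E).tangent γ s t (1 : ℝ) : E × E) =
      ((velocity (I := 𝓘(ℝ, E)) (fun r ↦ (γ r).proj) s t : E),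
        derivWithin (fun r ↦ fiberCoord (γ t).proj (γ r)) s t) := by
  refine (mfderiv_proj_fiberCoord (γ t) _).trans (Prod.ext ?_ ?_)
  · have h := mfderiv_comp_mfderivWithin t
      ((contMDiffAt_proj (TangentSpace 𝓘(ℝ, E) : M → Type _) (n := ∞)
        (p := γ t)).mdifferentiableAt (by simp)) hγ hs.uniqueMDiffWithinAt
    exact (DFunLike.congr_fun h (1 : ℝ)).symm
  · exact derivWithin_fiberCoord hs hγ (mem_chart_source E _)

/-- The velocity of a curve in `TM` is the sum of its horizontal and its vertical part. -/
lemma mfderivWithin_curve_eq_add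
    (cov : CovariantDerivative 𝓘(ℝ, E) E (TangentSpace 𝓘(ℝ, E) : M → Type _))
    {c : ℝ → M} {V : (t : ℝ) → TangentSpace 𝓘(ℝ, E) (c t)} {s : Set ℝ} {t : ℝ}
    (hs : UniqueDiffWithinAt ℝ s t)
    (hγ : MDifferentiableWithinAt 𝓘(ℝ, ℝ) 𝓘(ℝ, E).tangent
      (fun r ↦ (⟨c r, V r⟩ : TangentBundle 𝓘(ℝ, E) M)) s t) :
    (mfderivWithin 𝓘(ℝ, ℝ) 𝓘(ℝ, E).tangent
      (fun r ↦ (⟨c r, V r⟩ : TangentBundle 𝓘(ℝ, E) M)) s t (1 : ℝ) : E × E) =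
      (horizontalLift cov (⟨c t, V t⟩ : TangentBundle 𝓘(ℝ, E) M) (velocity c s t) : E × E) +
        (verticalLift (⟨c t, V t⟩ : TangentBundle 𝓘(ℝ, E) M) (covDerivAlong cov c s V t) :
          E × E) := by
  -- The extension of `V t` has constant coefficients in the trivialization at `c t`. The fibre part
  -- of the horizontal lift is therefore only $-\nabla_{\dot c}$ of the extension, and it cancels
  -- the connection term of `covDerivAlong`, leaving the plain derivative of the coefficients.
  have hz : secDeriv (FiberBundle.extend E (V t)) (c t) = (0 : E →L[ℝ] E) := by
    have h3 : (fun y ↦ (trivializationAt E (TangentSpace 𝓘(ℝ, E) : M → Type _) (c t)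
        (⟨y, FiberBundle.extend E (V t) y⟩ : TangentBundle 𝓘(ℝ, E) M)).2) =ᶠ[𝓝 (c t)]
          fun y ↦ (V t : E) := by
      filter_upwards [(trivializationAt E (TangentSpace 𝓘(ℝ, E) : M → Type _)
        (c t)).open_baseSet.mem_nhds (FiberBundle.mem_baseSet_trivializationAt E _ (c t))] with y hy
      exact triv_extend (c t) (V t) y hy
    have h4 : HasMFDerivAt 𝓘(ℝ, E) 𝓘(ℝ, E) _ (c t) (0 : E →L[ℝ] E) :=
      (hasMFDerivAt_const (I := 𝓘(ℝ, E)) (I' := 𝓘(ℝ, E)) (M' := E) (V t)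
        (c t)).congr_of_eventuallyEq h3
    exact h4.mfderiv
  have h1 := mfderivWithin_curve hs hγ
  have h2 := horizontalLift_self cov (c t) (V t) (velocity (I := 𝓘(ℝ, E)) c s t)
  have h3 := verticalLift_eq (I := 𝓘(ℝ, E)) (c t) (V t) (covDerivAlong cov c s V t)
  refine h1.trans ((congrArg₂ (fun p q : E × E ↦ p + q) h2 h3).trans ?_).symm
  refine Prod.ext (add_zero _) ?_
  have h5 : (covDerivAlong cov c s V t : E) =
      derivWithin (fun r ↦ fiberCoord (c t) (⟨c r, V r⟩ : TangentBundle 𝓘(ℝ, E) M)) s t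
        + covE cov (FiberBundle.extend E (V t)) (c t) (velocity (I := 𝓘(ℝ, E)) c s t) :=
    congrArg (fun z : E ↦ z + covE cov (FiberBundle.extend E (V t)) (c t)
      (velocity (I := 𝓘(ℝ, E)) c s t)) (triv_symm_self (c t) _)
  have h6 : ∀ (T : E →L[ℝ] E) (w k a d : E), T = 0 → a = d + k → T w - k + a = d := by
    rintro T w k a d rfl rfl
    simp
  exact h6 _ _ _ _ _ hz h5

/-- The fibre coordinates of `∇_w X`, for the vector fields `X` and `w` with constant coefficients
`u` and `w` in the preferred chart at `x₀`. -/
def christoffel (cov : CovariantDerivative 𝓘(ℝ, E) E (TangentSpace 𝓘(ℝ, E) : M → Type _))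
    (x₀ y : M) (u w : E) : E :=
  fiberCoord x₀ ⟨y, cov (constField x₀ u) y (constField x₀ w y)⟩

/-- `fiberCoord x₀` is linear on each fibre, so along the line $t\mapsto u+tw$ it is affine with
slope the coordinate of $w$. Here `x₀` stays fixed while `y` ranges over the chart domain, unlike in
`verticalLift_eq`. -/
lemma mfderiv_fiberCoord_verticalLift (hy : y ∈ (chartAt E x₀).source)
    (u w : TangentSpace 𝓘(ℝ, E) y) :
    (mfderiv 𝓘(ℝ, E).tangent 𝓘(ℝ, E) (fiberCoord x₀) (⟨y, u⟩ : TangentBundle 𝓘(ℝ, E) M)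
      (verticalLift (⟨y, u⟩ : TangentBundle 𝓘(ℝ, E) M) w) : E) = fiberCoord x₀ ⟨y, w⟩ := by
  have hlin := fiberCoord_linear (x₀ := x₀) hy
  let γ : ℝ → TangentBundle 𝓘(ℝ, E) M := fun t ↦ ⟨y, u + t • w⟩
  have e1 : ∀ t : ℝ, fiberCoord x₀ (γ t) = fiberCoord x₀ ⟨y, u⟩ + t • fiberCoord x₀ ⟨y, w⟩ :=
    fun t ↦ (hlin.map_add u (t • w)).trans (congrArg _ (hlin.map_smul t w))
  have hd : HasDerivAt (fun t : ℝ ↦ fiberCoord x₀ (γ t)) (fiberCoord x₀ ⟨y, w⟩) 0 := by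
    simp only [e1]
    simpa using ((hasDerivAt_id (0 : ℝ)).smul_const (fiberCoord x₀ ⟨y, w⟩)).const_add
      (fiberCoord x₀ ⟨y, u⟩)
  have hγ0 : γ 0 = ⟨y, u⟩ := by
    have : u + (0 : ℝ) • w = u := by rw [zero_smul, add_zero]
    exact congrArg (TotalSpace.mk y) this
  have hγ : MDifferentiableAt 𝓘(ℝ, ℝ) 𝓘(ℝ, E).tangent γ 0 := by
    have := (Trivialization.contMDiffAt_iff (IM := 𝓘(ℝ, ℝ)) (IB := 𝓘(ℝ, E)) (n := ∞)
      (e := trivializationAt E (TangentSpace 𝓘(ℝ, E) : M → Type _) x₀) (f := γ) (x₀ := 0)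
      ((Trivialization.mem_source _).2 hy)).2 ⟨contMDiffAt_const, by
        have : ContDiff ℝ ∞ fun t : ℝ ↦ fiberCoord x₀ (γ t) := by
          simp only [e1]
          exact contDiff_const.add (contDiff_id.smul contDiff_const)
        exact this.contMDiff.contMDiffAt⟩
    exact this.mdifferentiableAt (by simp)
  have h := derivWithin_fiberCoord (x₀ := x₀) (s := univ) (t := 0) uniqueDiffWithinAt_univ
    hγ.mdifferentiableWithinAt hy
  rw [mfderivWithin_univ, derivWithin_univ, hd.deriv, hγ0] at h
  exact h

/-- By `horizontalLift_eq` any differentiable field through $u$ may be used. The one with constant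
coefficients at `x₀` has constant fibre coordinate, so its differential contributes nothing and only
the vertical correction $-\nabla_wX$ survives. -/
lemma mfderiv_fiberCoord_horizontalLift [FiniteDimensional ℝ E]
    (cov : CovariantDerivative 𝓘(ℝ, E) E (TangentSpace 𝓘(ℝ, E) : M → Type _))
    (hy : y ∈ (chartAt E x₀).source) (u w : TangentSpace 𝓘(ℝ, E) y) :
    (mfderiv 𝓘(ℝ, E).tangent 𝓘(ℝ, E) (fiberCoord x₀) (⟨y, u⟩ : TangentBundle 𝓘(ℝ, E) M)
      (horizontalLift cov (⟨y, u⟩ : TangentBundle 𝓘(ℝ, E) M) w) : E) =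
        - christoffel cov x₀ y (fiberCoord x₀ ⟨y, u⟩) (fiberCoord x₀ ⟨y, w⟩) := by
  obtain ⟨u, rfl⟩ : ∃ u', u = constField x₀ u' y := ⟨_, (constField_fiberCoord hy u).symm⟩
  have hX := mdifferentiableAt_constField hy u
  have h1 := horizontalLift_eq cov y (constField x₀ u) hX w
  have h2 : mfderiv 𝓘(ℝ, E) 𝓘(ℝ, E) (fun y : M ↦ fiberCoord x₀ ⟨y, constField x₀ u y⟩) y =
      (0 : E →L[ℝ] E) := by
    have h3 : (fun y : M ↦ fiberCoord x₀ ⟨y, constField x₀ u y⟩) =ᶠ[𝓝 y] fun _ ↦ u := by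
      filter_upwards [(chartAt E x₀).open_source.mem_nhds hy] with z hz
      exact fiberCoord_constField hz u
    exact ((hasMFDerivAt_const (I := 𝓘(ℝ, E)) (I' := 𝓘(ℝ, E)) u
      y).congr_of_eventuallyEq h3).mfderiv
  have h4 := mfderiv_comp y ((contMDiffAt_fiberCoord (x₀ := x₀)
    (v := (⟨y, constField x₀ u y⟩ : TangentBundle 𝓘(ℝ, E) M)) hy).mdifferentiableAt (by simp)) hX
  have h5 := mfderiv_fiberCoord_verticalLift hy (constField x₀ u y) (cov (constField x₀ u) y w)
  rw [h1, map_sub, h5, fiberCoord_constField hy, christoffel, constField_fiberCoord hy]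
  have h6 := (DFunLike.congr_fun h4 w).symm.trans (DFunLike.congr_fun h2 w)
  exact (congrArg (fun z : E ↦ z - _) h6).trans (zero_sub _)

/-- The covariant derivative along a curve in the coordinates at `x₀`. -/
lemma derivWithin_fiberCoord_eq [FiniteDimensional ℝ E]
    (cov : CovariantDerivative 𝓘(ℝ, E) E (TangentSpace 𝓘(ℝ, E) : M → Type _))
    {c : ℝ → M} {V : (t : ℝ) → TangentSpace 𝓘(ℝ, E) (c t)} {s : Set ℝ} {t : ℝ}
    (hs : UniqueDiffWithinAt ℝ s t)
    (hγ : MDifferentiableWithinAt 𝓘(ℝ, ℝ) 𝓘(ℝ, E).tangent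
      (fun r ↦ (⟨c r, V r⟩ : TangentBundle 𝓘(ℝ, E) M)) s t)
    (hx : c t ∈ (chartAt E x₀).source) :
    derivWithin (fun r ↦ fiberCoord x₀ ⟨c r, V r⟩) s t =
      - christoffel cov x₀ (c t) (fiberCoord x₀ ⟨c t, V t⟩) (fiberCoord x₀ ⟨c t, velocity c s t⟩)
        + fiberCoord x₀ ⟨c t, covDerivAlong cov c s V t⟩ := by
  have h1 := derivWithin_fiberCoord hs hγ hx
  have h2 := mfderivWithin_curve_eq_add cov hs hγ
  refine h1.symm.trans ?_
  let T : E × E →L[ℝ] E := mfderiv 𝓘(ℝ, E).tangent 𝓘(ℝ, E) (fiberCoord x₀)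
    (⟨c t, V t⟩ : TangentBundle 𝓘(ℝ, E) M)
  exact (congrArg T h2).trans ((T.map_add _ _).trans (congrArg₂ _
    (mfderiv_fiberCoord_horizontalLift cov hx (V t) (velocity c s t))
    (mfderiv_fiberCoord_verticalLift hx (V t) (covDerivAlong cov c s V t))))

/-- The fibre coordinates of the velocity are the derivatives of the base coordinates. -/
lemma fiberCoord_velocity {c : ℝ → M} {s : Set ℝ} {t : ℝ} (hs : UniqueDiffWithinAt ℝ s t)
    (hc : MDifferentiableWithinAt 𝓘(ℝ, ℝ) 𝓘(ℝ, E) c s t) (hx : c t ∈ (chartAt E x₀).source) :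
    fiberCoord x₀ ⟨c t, velocity c s t⟩ =
      derivWithin (fun r ↦ extChartAt 𝓘(ℝ, E) x₀ (c r)) s t := by
  have h := mfderiv_comp_mfderivWithin t
    (mdifferentiableAt_extChartAt (I := 𝓘(ℝ, E)) hx) hc hs.uniqueMDiffWithinAt
  rw [mfderivWithin_eq_fderivWithin, ← TangentBundle.continuousLinearMapAt_trivializationAt hx] at h
  rw [← fderivWithin_derivWithin]
  refine Eq.trans ?_ (DFunLike.congr_fun h (1 : ℝ)).symm
  exact (congrFun ((trivializationAt E (TangentSpace 𝓘(ℝ, E) : M → Type _)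
    x₀).coe_linearMapAt_of_mem (R := ℝ) hx) _).symm

end Coordinates

/-! ### Bilinearity and smoothness of the Christoffel symbols. -/

section Christoffel

variable {E : Type*} [NormedAddCommGroup E] [NormedSpace ℝ E]
  {M : Type*} [TopologicalSpace M] [ChartedSpace E M] [IsManifold 𝓘(ℝ, E) ∞ M] {x₀ y : M}
  (cov : CovariantDerivative 𝓘(ℝ, E) E (TangentSpace 𝓘(ℝ, E) : M → Type _))

lemma christoffel_linear_right (hy : y ∈ (chartAt E x₀).source) (u : E) :
    IsLinearMap ℝ fun w ↦ christoffel cov x₀ y u w where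
  map_add w w' := by
    simp only [christoffel, (constField_linear hy).map_add, map_add]
    exact (fiberCoord_linear hy).map_add _ _
  map_smul r w := by
    simp only [christoffel, (constField_linear hy).map_smul, map_smul]
    exact (fiberCoord_linear hy).map_smul _ _

/-- Constant fields depend linearly on their coefficients only over the chart domain, so locality of
the connection is needed before its additivity and homogeneity apply. -/
lemma christoffel_linear_left (hy : y ∈ (chartAt E x₀).source) (w : E) :
    IsLinearMap ℝ fun u ↦ christoffel cov x₀ y u w where
  map_add u u' := by
    have hu := mdifferentiableAt_constField hy u
    have hu' := mdifferentiableAt_constField hy u'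
    have h : cov (constField x₀ (u + u')) y = cov (constField x₀ u) y + cov (constField x₀ u') y := by
      rw [← cov.isCovariantDerivativeOnUniv.add hu hu']
      refine cov.isCovariantDerivativeOnUniv.congr_of_eventuallyEq
        (mdifferentiableAt_constField hy _) (mdifferentiableAt_add_section hu hu')
        Filter.univ_mem ?_
      filter_upwards [(chartAt E x₀).open_source.mem_nhds hy] with z hz
      exact (constField_linear hz).map_add u u'
    simp only [christoffel, h]
    exact (fiberCoord_linear hy).map_add _ _
  map_smul r u := by
    have hu := mdifferentiableAt_constField hy u
    have h : cov (constField x₀ (r • u)) y = r • cov (constField x₀ u) y := by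
      rw [← cov.isCovariantDerivativeOnUniv.smul_const r hu]
      refine cov.isCovariantDerivativeOnUniv.congr_of_eventuallyEq
        (mdifferentiableAt_constField hy _) hu.smul_const_section
        Filter.univ_mem ?_
      filter_upwards [(chartAt E x₀).open_source.mem_nhds hy] with z hz
      exact (constField_linear hz).map_smul r u
    simp only [christoffel, h]
    exact (fiberCoord_linear hy).map_smul _ _

/-- The Christoffel symbols are smooth near `x₀`. The connection is only assumed to map smooth
global vector fields to smooth ones, so that the constant fields have to be cut off. -/
lemma contMDiffOn_christoffel [FiniteDimensional ℝ E] [T2Space M]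
    [CovariantDerivative.ContMDiffCovariantDerivative cov ∞] (x₀ : M) :
    ∃ W : Set M, IsOpen W ∧ x₀ ∈ W ∧ W ⊆ (chartAt E x₀).source ∧
      ∀ u w, ContMDiffOn 𝓘(ℝ, E) 𝓘(ℝ, E) ∞ (fun y ↦ christoffel cov x₀ y u w) W := by
  let ψ : SmoothBumpFunction 𝓘(ℝ, E) x₀ := Classical.arbitrary _
  obtain ⟨W₁, hW₁ψ, hW₁, hxW₁⟩ := eventually_nhds_iff.1 ψ.eventuallyEq_one
  refine ⟨W₁ ∩ (chartAt E x₀).source, hW₁.inter (chartAt E x₀).open_source,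
    ⟨hxW₁, mem_chart_source E x₀⟩, inter_subset_right, fun u w ↦ ?_⟩
  let X : (y : M) → TangentSpace 𝓘(ℝ, E) y := (ψ : M → ℝ) • constField x₀ u
  have hX : ContMDiff 𝓘(ℝ, E) 𝓘(ℝ, E).tangent ∞
      (fun y ↦ (⟨y, X y⟩ : TangentBundle 𝓘(ℝ, E) M)) :=
    ContMDiffOn.smul_section_of_tsupport ψ.contMDiff.contMDiffOn (chartAt E x₀).open_source
      ψ.tsupport_subset_chartAt_source (contMDiffOn_constField x₀ u)
  have hcovX := (CovariantDerivative.ContMDiffCovariantDerivative.contMDiff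
    (cov := cov) (k := ∞)).contMDiff (σ := X) hX.contMDiffOn
  intro y hy
  have h1 := (hcovX.contMDiffAt Filter.univ_mem).clm_bundle_apply (x := y)
    ((contMDiffOn_constField x₀ w).contMDiffAt ((chartAt E x₀).open_source.mem_nhds hy.2))
  have h2 := (contMDiffAt_fiberCoord (x₀ := x₀)
    (v := (⟨y, cov X y (constField x₀ w y)⟩ : TangentBundle 𝓘(ℝ, E) M)) hy.2).comp y h1
  refine (h2.congr_of_eventuallyEq ?_).contMDiffWithinAt
  filter_upwards [(hW₁.inter (chartAt E x₀).open_source).mem_nhds hy] with z hz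
  have : cov (constField x₀ u) z = cov X z := by
    refine cov.isCovariantDerivativeOnUniv.congr_of_eventuallyEq
      (mdifferentiableAt_constField hz.2 u) (hX.mdifferentiableAt (by simp)) Filter.univ_mem ?_
    filter_upwards [hW₁.mem_nhds hz.1] with z' hz'
    have h1 : ψ z' = 1 := hW₁ψ z' hz'
    change _ = ψ z' • constField x₀ u z'
    rw [h1, one_smul]
  simp only [christoffel, this]
  rfl

/-- The Christoffel symbols in the preferred chart at `x₀`, as a smooth family of bilinear maps. -/
lemma exists_contDiffOn_christoffel [FiniteDimensional ℝ E] [T2Space M]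
    [CovariantDerivative.ContMDiffCovariantDerivative cov ∞] (x₀ : M) :
    ∃ O : Set E, IsOpen O ∧ extChartAt 𝓘(ℝ, E) x₀ x₀ ∈ O ∧ O ⊆ (extChartAt 𝓘(ℝ, E) x₀).target ∧
      ∃ Γ : E → E →L[ℝ] E →L[ℝ] E, ContDiffOn ℝ ∞ Γ O ∧ ∀ y ∈ (chartAt E x₀).source,
        extChartAt 𝓘(ℝ, E) x₀ y ∈ O → ∀ u w,
          Γ (extChartAt 𝓘(ℝ, E) x₀ y) u w = christoffel cov x₀ y u w := by
  obtain ⟨W, hW, hxW, hWs, hsm⟩ := contMDiffOn_christoffel cov x₀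
  let φ := extChartAt 𝓘(ℝ, E) x₀
  let O : Set E := φ.target ∩ φ.symm ⁻¹' W
  have hO : IsOpen O :=
    (continuousOn_extChartAt_symm x₀).isOpen_inter_preimage (isOpen_extChartAt_target x₀) hW
  have hOs : ∀ z ∈ O, φ.symm z ∈ (chartAt E x₀).source := fun z hz ↦ hWs hz.2
  -- The default 0 is harmless: every point of `O` is sent by `φ.symm` into the chart domain.
  let B : E → E →ₗ[ℝ] E →ₗ[ℝ] E := fun z ↦ by
    classical
    exact if hz : φ.symm z ∈ (chartAt E x₀).source then
      LinearMap.mk₂ ℝ (christoffel cov x₀ (φ.symm z))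
        (fun u u' w ↦ (christoffel_linear_left cov hz w).map_add u u')
        (fun r u w ↦ (christoffel_linear_left cov hz w).map_smul r u)
        (fun u w w' ↦ (christoffel_linear_right cov hz u).map_add w w')
        (fun r u w ↦ (christoffel_linear_right cov hz u).map_smul r w)
      else 0
  have hB : ∀ z, φ.symm z ∈ (chartAt E x₀).source → ∀ u w,
      B z u w = christoffel cov x₀ (φ.symm z) u w := fun z hz u w ↦ by
    simp only [B, dif_pos hz, LinearMap.mk₂_apply]
  let Γ : E → E →L[ℝ] E →L[ℝ] E := fun z ↦ LinearMap.toContinuousLinearMap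
    ((LinearMap.toContinuousLinearMap : (E →ₗ[ℝ] E) ≃ₗ[ℝ] (E →L[ℝ] E)).toLinearMap ∘ₗ B z)
  have hΓ : ∀ z u w, Γ z u w = B z u w := fun z u w ↦ rfl
  refine ⟨O, hO, ⟨mem_extChartAt_target x₀, by simpa [φ] using hxW⟩, inter_subset_left, Γ,
    ?_, fun y hy _ u w ↦ ?_⟩
  · rw [contDiffOn_clm_apply]
    intro u
    rw [contDiffOn_clm_apply]
    intro w
    have h := (hsm u w).comp ((contMDiffOn_extChartAt_symm (I := 𝓘(ℝ, E)) (n := ∞) x₀).mono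
      (inter_subset_left : O ⊆ _)) fun z hz ↦ hz.2
    refine (contMDiffOn_iff_contDiffOn.1 h).congr fun z hz ↦ ?_
    rw [hΓ, hB z (hOs z hz)]
    rfl
  · have hy' : φ.symm (φ y) = y := φ.left_inv (by simpa [φ] using hy)
    rw [hΓ, hB _ (by rw [hy']; exact hy), hy']

end Christoffel

/-! ### Distributions, geodesics and tangency in a chart. -/

section Main

variable {E : Type*} [NormedAddCommGroup E] [NormedSpace ℝ E]
  {M : Type*} [TopologicalSpace M] [ChartedSpace E M] [IsManifold 𝓘(ℝ, E) ∞ M]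

/-- A smooth distribution is locally the kernel of a smooth family of projections of the fibre
coordinates. -/
lemma IsSmoothDistribution.exists_projection [FiniteDimensional ℝ E]
    {D : (x : M) → Submodule ℝ (TangentSpace 𝓘(ℝ, E) x)} {p : ℕ} (hD : IsSmoothDistribution D p)
    (x₀ : M) :
    ∃ O : Set E, IsOpen O ∧ extChartAt 𝓘(ℝ, E) x₀ x₀ ∈ O ∧
      ∃ A : E → E →L[ℝ] E, ContDiffOn ℝ ∞ A O ∧ (∀ z ∈ O, ∀ w, A z (A z w) = A z w) ∧
        ∀ v : TangentBundle 𝓘(ℝ, E) M, v.proj ∈ (chartAt E x₀).source →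
          extChartAt 𝓘(ℝ, E) x₀ v.proj ∈ O →
          (A (extChartAt 𝓘(ℝ, E) x₀ v.proj) (fiberCoord x₀ v) = 0 ↔ v ∈ totalSet D) := by
  obtain ⟨U, hU, hxU, X, hX, hXD⟩ := hD x₀
  let φ := extChartAt 𝓘(ℝ, E) x₀
  have hφ : ∀ {y}, y ∈ (chartAt E x₀).source → φ.symm (φ y) = y :=
    fun hy ↦ φ.left_inv (by simpa [φ] using hy)
  have hφt : ∀ z ∈ φ.target, φ.symm z ∈ (chartAt E x₀).source :=
    fun z hz ↦ by simpa [φ] using φ.map_target hz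
  let O₁ : Set E := φ.target ∩ φ.symm ⁻¹' U
  have hO₁ : IsOpen O₁ :=
    (continuousOn_extChartAt_symm x₀).isOpen_inter_preimage (isOpen_extChartAt_target x₀) hU
  let ξ : Fin p → E → E := fun i z ↦ fiberCoord x₀ ⟨φ.symm z, X i (φ.symm z)⟩
  have hξ : ∀ i, ContDiffOn ℝ ∞ (ξ i) O₁ := by
    intro i
    rw [← contMDiffOn_iff_contDiffOn]
    have h := (hX i).comp ((contMDiffOn_extChartAt_symm (I := 𝓘(ℝ, E)) (n := ∞) x₀).mono
      (inter_subset_left : O₁ ⊆ _)) fun z hz ↦ hz.2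
    exact fun z hz ↦ (h z hz).fiberCoord (hφt z hz.1)
  have hker : ∀ {y} (hy : y ∈ (chartAt E x₀).source), LinearMap.ker (fiberCoordₗ hy) = ⊥ :=
    fun hy ↦ LinearMap.ker_eq_bot.2 fun w w' h ↦ fiberCoord_inj hy h
  have hli : ∀ z ∈ O₁, LinearIndependent ℝ fun i ↦ ξ i z := fun z hz ↦
    (hXD _ hz.2).1.map' (fiberCoordₗ (hφt z hz.1)) (hker _)
  have hz₀ : φ x₀ ∈ O₁ := ⟨mem_extChartAt_target x₀, by
    change φ.symm (φ x₀) ∈ U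
    rwa [hφ (mem_chart_source E x₀)]⟩
  obtain ⟨O, hOO₁, hO, hzO, A, hA, hAO⟩ := exists_contDiffOn_projection hO₁ hξ hz₀ (hli _ hz₀)
  refine ⟨O, hO, hzO, A, hA, fun z hz ↦ (hAO z hz).1, ?_⟩
  rintro ⟨y, w⟩ hy hyO
  rw [(hAO _ hyO).2]
  change y ∈ _ at hy
  change φ y ∈ O at hyO
  have hy' := hφ hy
  -- The injective fibre coordinate map carries the span of the frame at `y` onto the span of its
  -- coordinates, so membership can be tested on either side.
  have h1 : Submodule.span ℝ (range fun i ↦ ξ i (φ y)) =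
      (Submodule.span ℝ (range fun i ↦ X i y)).map (fiberCoordₗ hy) := by
    rw [Submodule.map_span, ← range_comp]
    have : (fun i ↦ ξ i (φ y)) = fun i ↦ fiberCoordₗ hy (X i y) := by
      funext i
      exact congrArg (fun y' ↦ fiberCoord x₀ ⟨y', X i y'⟩) hy'
    rw [this]
    rfl
  change fiberCoord x₀ ⟨y, w⟩ ∈ Submodule.span ℝ (range fun i ↦ ξ i (φ y)) ↔ w ∈ D y
  have hyU : y ∈ U := by
    have := (hOO₁ hyO).2
    rwa [mem_preimage, hy'] at this
  rw [h1, (hXD y hyU).2, Submodule.mem_map]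
  exact ⟨fun ⟨w', hw', h⟩ ↦ fiberCoord_inj hy h ▸ hw', fun h ↦ ⟨w, h, rfl⟩⟩

/-- The velocity curve is the tangent map of `c` applied to the smooth section $t\mapsto(t,1)$ of
$T\mathbb R$. -/
lemma contMDiffOn_velocity {c : ℝ → M} {s : Set ℝ} (hs : UniqueDiffOn ℝ s)
    (hc : ContMDiffOn 𝓘(ℝ, ℝ) 𝓘(ℝ, E) ∞ c s) :
    ContMDiffOn 𝓘(ℝ, ℝ) 𝓘(ℝ, E).tangent ∞
      (fun t ↦ (⟨c t, velocity c s t⟩ : TangentBundle 𝓘(ℝ, E) M)) s := by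
  have h1 := hc.contMDiffOn_tangentMapWithin (m := ∞) (by simp) hs.uniqueMDiffOn
  have h2 : ContMDiff 𝓘(ℝ, ℝ) 𝓘(ℝ, ℝ).tangent ∞
      (fun t : ℝ ↦ (⟨t, (1 : ℝ)⟩ : TangentBundle 𝓘(ℝ, ℝ) ℝ)) :=
    contMDiff_vectorSpace_iff_contDiff.2 contDiff_const
  exact h1.comp h2.contMDiffOn fun t ht ↦ ht

variable {cov : CovariantDerivative 𝓘(ℝ, E) E (TangentSpace 𝓘(ℝ, E) : M → Type _)}

/-- The geodesic equation in the coordinates at `x₀`. -/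
lemma IsGeodesicOn.hasDerivWithinAt [FiniteDimensional ℝ E] {c : ℝ → M} {s : Set ℝ}
    (hc : IsGeodesicOn cov c s) (hs : UniqueDiffOn ℝ s) {x₀ : M} {t : ℝ} (ht : t ∈ s)
    (hx : c t ∈ (chartAt E x₀).source) :
    HasDerivWithinAt (fun r ↦ extChartAt 𝓘(ℝ, E) x₀ (c r))
        (fiberCoord x₀ ⟨c t, velocity c s t⟩) s t ∧
      HasDerivWithinAt (fun r ↦ fiberCoord x₀ ⟨c r, velocity c s r⟩)
        (-christoffel cov x₀ (c t) (fiberCoord x₀ ⟨c t, velocity c s t⟩)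
          (fiberCoord x₀ ⟨c t, velocity c s t⟩)) s t := by
  have hcd := (hc.contMDiffOn t ht).mdifferentiableWithinAt (by simp)
  have hγd := (contMDiffOn_velocity hs hc.contMDiffOn t ht).mdifferentiableWithinAt (by simp)
  have h1 : DifferentiableWithinAt ℝ (fun r ↦ extChartAt 𝓘(ℝ, E) x₀ (c r)) s t :=
    mdifferentiableWithinAt_iff_differentiableWithinAt.1
      ((mdifferentiableAt_extChartAt (I := 𝓘(ℝ, E)) hx).comp_mdifferentiableWithinAt t hcd)
  have h2 : DifferentiableWithinAt ℝ (fun r ↦ fiberCoord x₀ ⟨c r, velocity c s r⟩) s t :=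
    mdifferentiableWithinAt_iff_differentiableWithinAt.1
      (((contMDiffOn_velocity hs hc.contMDiffOn t ht).fiberCoord hx).mdifferentiableWithinAt
        (by simp))
  have h3 := derivWithin_fiberCoord_eq cov (hs t ht) hγd hx
  rw [hc.covDerivAlong_velocity t ht, (fiberCoord_linear hx).map_zero, add_zero] at h3
  refine ⟨?_, ?_⟩
  · rw [fiberCoord_velocity (hs t ht) hcd hx]
    exact h1.hasDerivWithinAt
  · rw [← h3]
    exact h2.hasDerivWithinAt

/-- The velocity curve of a geodesic is an integral curve of the spray. -/
lemma IsGeodesicOn.mfderivWithin_velocity {c : ℝ → M} {s : Set ℝ}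
    (hc : IsGeodesicOn cov c s) (hs : UniqueDiffOn ℝ s) {t : ℝ} (ht : t ∈ s) :
    (mfderivWithin 𝓘(ℝ, ℝ) 𝓘(ℝ, E).tangent
      (fun r ↦ (⟨c r, velocity c s r⟩ : TangentBundle 𝓘(ℝ, E) M)) s t (1 : ℝ) : E × E) =
      geodesicSpray cov ⟨c t, velocity c s t⟩ := by
  have hγd := (contMDiffOn_velocity hs hc.contMDiffOn t ht).mdifferentiableWithinAt (by simp)
  have h := mfderivWithin_curve_eq_add cov (hs t ht) hγd
  rw [hc.covDerivAlong_velocity t ht] at h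
  exact h.trans ((congrArg (fun q : E × E ↦ _ + q)
    (verticalLift_eq (I := 𝓘(ℝ, E)) (c t) (velocity (I := 𝓘(ℝ, E)) c s t) (0 : E))).trans (add_zero _))

/-- A solution of the geodesic equation in coordinates defines a geodesic. -/
lemma isGeodesicOn_of_hasDerivAt [FiniteDimensional ℝ E] {x₀ : M} {O : Set E}
    (hO : O ⊆ (extChartAt 𝓘(ℝ, E) x₀).target) {Γ : E → E →L[ℝ] E →L[ℝ] E}
    (hΓ : ∀ y ∈ (chartAt E x₀).source, extChartAt 𝓘(ℝ, E) x₀ y ∈ O → ∀ u w,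
      Γ (extChartAt 𝓘(ℝ, E) x₀ y) u w = christoffel cov x₀ y u w)
    {s : Set ℝ} (hs : UniqueDiffOn ℝ s) {x v : ℝ → E} (hx : ContDiffOn ℝ ∞ x s)
    (hsol : ∀ t ∈ s, x t ∈ O ∧ HasDerivAt x (v t) t ∧ HasDerivAt v (-(Γ (x t) (v t) (v t))) t) :
    IsGeodesicOn cov (fun t ↦ (extChartAt 𝓘(ℝ, E) x₀).symm (x t)) s ∧
      ∀ t ∈ s, velocity (fun t ↦ (extChartAt 𝓘(ℝ, E) x₀).symm (x t)) s t =
        constField x₀ (v t) ((extChartAt 𝓘(ℝ, E) x₀).symm (x t)) := by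
  set φ := extChartAt 𝓘(ℝ, E) x₀ with hφdef
  set c : ℝ → M := fun t ↦ φ.symm (x t) with hcdef
  have hcs : ∀ t ∈ s, c t ∈ (chartAt E x₀).source := fun t ht ↦ by
    have h := φ.map_target (hO (hsol t ht).1)
    rwa [hφdef, extChartAt_source, ← hφdef] at h
  have hφc : ∀ t ∈ s, φ (c t) = x t := fun t ht ↦ φ.right_inv (hO (hsol t ht).1)
  have hc : ContMDiffOn 𝓘(ℝ, ℝ) 𝓘(ℝ, E) ∞ c s :=
    (contMDiffOn_extChartAt_symm (I := 𝓘(ℝ, E)) (n := ∞) x₀).comp hx.contMDiffOn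
      fun t ht ↦ hO (hsol t ht).1
  have hvel : ∀ t ∈ s, fiberCoord x₀ ⟨c t, velocity c s t⟩ = v t := by
    intro t ht
    rw [fiberCoord_velocity (hs t ht) ((hc t ht).mdifferentiableWithinAt (by simp)) (hcs t ht),
      derivWithin_congr hφc (hφc t ht)]
    exact (hsol t ht).2.1.hasDerivWithinAt.derivWithin (hs t ht)
  refine ⟨⟨hc, fun t ht ↦ fiberCoord_inj (hcs t ht) ?_⟩, fun t ht ↦ ?_⟩
  · have hγd := (contMDiffOn_velocity hs hc t ht).mdifferentiableWithinAt (by simp)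
    -- In general $v'=-\Gamma(v,v)$ plus the coordinates of $\nabla_{\dot c}\dot c$; comparison with
    -- the equation satisfied by $v$ makes the last term vanish.
    have h := derivWithin_fiberCoord_eq cov (hs t ht) hγd (hcs t ht)
    rw [derivWithin_congr hvel (hvel t ht),
      (hsol t ht).2.2.hasDerivWithinAt.derivWithin (hs t ht), hvel t ht,
      ← hΓ _ (hcs t ht) (by rw [hφc t ht]; exact (hsol t ht).1), hφc t ht] at h
    rw [(fiberCoord_linear (hcs t ht)).map_zero]
    exact (left_eq_add.1 h)
  · rw [← hvel t ht, constField_fiberCoord (hcs t ht)]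

/-- Tangency of the spray in coordinates. -/
lemma fderiv_apply_sub_eq_zero_of_mem_tangentVectors [FiniteDimensional ℝ E] {x₀ : M} {O : Set E}
    (hO : IsOpen O) {A : E → E →L[ℝ] E} (hA : ContDiffOn ℝ ∞ A O)
    {S : Set (TangentBundle 𝓘(ℝ, E) M)} (hS : ∀ v : TangentBundle 𝓘(ℝ, E) M,
      v.proj ∈ (chartAt E x₀).source → extChartAt 𝓘(ℝ, E) x₀ v.proj ∈ O → v ∈ S →
        A (extChartAt 𝓘(ℝ, E) x₀ v.proj) (fiberCoord x₀ v) = 0)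
    {v : TangentBundle 𝓘(ℝ, E) M} (hv : v.proj ∈ (chartAt E x₀).source)
    (hvO : extChartAt 𝓘(ℝ, E) x₀ v.proj ∈ O) (hvS : geodesicSpray cov v ∈ tangentVectors S v) :
    fderiv ℝ A (extChartAt 𝓘(ℝ, E) x₀ v.proj) (fiberCoord x₀ v) (fiberCoord x₀ v) -
      A (extChartAt 𝓘(ℝ, E) x₀ v.proj)
        (christoffel cov x₀ v.proj (fiberCoord x₀ v) (fiberCoord x₀ v)) = 0 := by
  obtain ⟨ε, γ, hε, rfl, hγ, hγS, hγZ⟩ := hvS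
  have h0 : Ioo (-ε) ε ∈ 𝓝 (0 : ℝ) := Ioo_mem_nhds (by linarith) hε
  have hγd : MDifferentiableAt 𝓘(ℝ, ℝ) 𝓘(ℝ, E).tangent γ 0 :=
    (hγ.contMDiffAt h0).mdifferentiableAt (by simp)
  have hcd : MDifferentiableAt 𝓘(ℝ, ℝ) 𝓘(ℝ, E) (fun t ↦ (γ t).proj) 0 :=
    ((contMDiffAt_proj (TangentSpace 𝓘(ℝ, E) : M → Type _) (n := ∞)
      (p := γ 0)).mdifferentiableAt (by simp)).comp 0 hγd
  let x : ℝ → E := fun t ↦ extChartAt 𝓘(ℝ, E) x₀ (γ t).proj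
  let V : ℝ → E := fun t ↦ fiberCoord x₀ (γ t)
  have hZ : (geodesicSpray cov (γ 0) : E × E).1 = (γ 0).2 :=
    congrArg Prod.fst (horizontalLift_self cov (γ 0).proj (γ 0).2 (γ 0).2)
  -- `γ` need not be the velocity curve of its projection, but at time 0 its derivative is the
  -- spray, whose base component is `γ 0` itself.
  have hvel : velocity (I := 𝓘(ℝ, E)) (fun t ↦ (γ t).proj) univ 0 = (γ 0).2 := by
    have h := mfderivWithin_curve (s := univ) uniqueDiffWithinAt_univ hγd.mdifferentiableWithinAt
    rw [mfderivWithin_univ] at h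
    exact (congrArg Prod.fst (h.symm.trans hγZ)).trans hZ
  have hx' : HasDerivAt x (V 0) 0 := by
    have h := fiberCoord_velocity (x₀ := x₀) (s := univ) uniqueDiffWithinAt_univ
      hcd.mdifferentiableWithinAt hv
    rw [hvel, derivWithin_univ] at h
    have hd : DifferentiableAt ℝ x 0 := mdifferentiableAt_iff_differentiableAt.1
      ((mdifferentiableAt_extChartAt (I := 𝓘(ℝ, E)) hv).comp 0 hcd)
    have := hd.hasDerivAt
    rwa [← h] at this
  have hV' : HasDerivAt V (-christoffel cov x₀ (γ 0).proj (V 0) (V 0)) 0 := by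
    have h := derivWithin_fiberCoord (x₀ := x₀) (s := univ) uniqueDiffWithinAt_univ
      hγd.mdifferentiableWithinAt hv
    rw [mfderivWithin_univ, hγZ, derivWithin_univ] at h
    have h2 := mfderiv_fiberCoord_horizontalLift cov hv (γ 0).2 (γ 0).2
    have hd : DifferentiableAt ℝ V 0 := mdifferentiableAt_iff_differentiableAt.1
      (((contMDiffAt_fiberCoord hv).mdifferentiableAt (by simp)).comp 0 hγd)
    have h3 : deriv V 0 = -christoffel cov x₀ (γ 0).proj (V 0) (V 0) := h.symm.trans h2
    rw [← h3]
    exact hd.hasDerivAt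
  have hA' : HasDerivAt (fun t ↦ A (x t)) (fderiv ℝ A (x 0) (V 0)) 0 :=
    ((hA.differentiableOn (by simp)).differentiableAt
      (hO.mem_nhds hvO)).hasFDerivAt.comp_hasDerivAt (0 : ℝ) hx'
  have hu := hA'.clm_apply hV'
  -- `γ` stays in `S`, so $A(x)V$ vanishes near 0, and the derivative `hu` computed by the product
  -- rule must be 0.
  have hzero : (fun t ↦ A (x t) (V t)) =ᶠ[𝓝 0] fun _ ↦ 0 := by
    have h1 : ∀ᶠ t in 𝓝 (0 : ℝ), (γ t).proj ∈ (chartAt E x₀).source :=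
      hcd.continuousAt.eventually ((chartAt E x₀).open_source.mem_nhds hv)
    filter_upwards [h0, h1, hx'.continuousAt.eventually (hO.mem_nhds hvO)] with t ht h1 h2
    exact hS _ h1 h2 (hγS t ht)
  have h := (hu.congr_of_eventuallyEq hzero.symm).unique (hasDerivAt_const 0 0)
  rw [map_neg, ← sub_eq_add_neg] at h
  exact h

end Main

/-! ### The two implications. -/

section Main

variable {E : Type*} [NormedAddCommGroup E] [NormedSpace ℝ E] [FiniteDimensional ℝ E]
  {M : Type*} [TopologicalSpace M] [ChartedSpace E M] [IsManifold 𝓘(ℝ, E) ∞ M]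
  {cov : CovariantDerivative 𝓘(ℝ, E) E (TangentSpace 𝓘(ℝ, E) : M → Type _)}
  {D : (x : M) → Submodule ℝ (TangentSpace 𝓘(ℝ, E) x)} {p : ℕ}

/-- Along a geodesic, the condition that the velocity lies in `D` is closed. -/
lemma IsSmoothDistribution.mem_of_mem_closure (hD : IsSmoothDistribution D p) {c : ℝ → M}
    {s : Set ℝ} (hs : UniqueDiffOn ℝ s) (hc : IsGeodesicOn cov c s) {t₀ : ℝ} (ht₀ : t₀ ∈ s)
    (hcl : t₀ ∈ closure ({t | velocity c s t ∈ D (c t)} ∩ s)) : velocity c s t₀ ∈ D (c t₀) := by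
  obtain ⟨O, hO, hzO, A, hA, -, hAD⟩ := hD.exists_projection (c t₀)
  have hx₀ := mem_chart_source E (c t₀)
  obtain ⟨hx', hv'⟩ := hc.hasDerivWithinAt hs ht₀ hx₀
  have hu : ContinuousWithinAt (fun t ↦ A (extChartAt 𝓘(ℝ, E) (c t₀) (c t))
      (fiberCoord (c t₀) ⟨c t, velocity c s t⟩)) s t₀ :=
    (ContinuousAt.comp_continuousWithinAt (f := fun r ↦ extChartAt 𝓘(ℝ, E) (c t₀) (c r))
      (hA.continuousOn.continuousAt (hO.mem_nhds hzO)) hx'.continuousWithinAt).clm_apply hv'.continuousWithinAt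
  have hgood : ∀ᶠ t in 𝓝[s] t₀, c t ∈ (chartAt E (c t₀)).source ∧
      extChartAt 𝓘(ℝ, E) (c t₀) (c t) ∈ O :=
    ((hc.contMDiffOn.continuousOn t₀ ht₀).eventually
      ((chartAt E (c t₀)).open_source.mem_nhds hx₀)).and
      (hx'.continuousWithinAt.eventually (hO.mem_nhds hzO))
  refine (hAD ⟨c t₀, velocity c s t₀⟩ hx₀ hzO).1 ?_
  by_contra hne
  have hev := (hgood.and (hu.eventually_ne hne))
  rw [eventually_nhdsWithin_iff] at hev
  obtain ⟨t, ⟨htD, hts⟩, ht⟩ := ((mem_closure_iff_frequently.1 hcl).and_eventually hev).exists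
  exact (ht hts).2 ((hAD ⟨c t, velocity c s t⟩ (ht hts).1.1 (ht hts).1.2).2 htD)

/-- If the spray is tangent to `D`, then a geodesic tangent to `D` stays so for a short time. -/
lemma IsSmoothDistribution.exists_gt_of_isTangentTo [T2Space M]
    [CovariantDerivative.ContMDiffCovariantDerivative cov ∞] (hD : IsSmoothDistribution D p)
    (hZ : IsTangentTo (geodesicSpray cov) (totalSet D)) {a b : ℝ} {c : ℝ → M}
    (hc : IsGeodesicOn cov c (Icc a b)) {t₀ : ℝ} (ht₀ : t₀ ∈ Ico a b)
    (hD₀ : velocity c (Icc a b) t₀ ∈ D (c t₀)) {y : ℝ} (hy : t₀ < y) :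
    ∃ t ∈ Ioc t₀ y, velocity c (Icc a b) t ∈ D (c t) := by
  have hs : UniqueDiffOn ℝ (Icc a b) := uniqueDiffOn_Icc (ht₀.1.trans_lt ht₀.2)
  set s := Icc a b with hsdef
  set x₀ := c t₀ with hx₀def
  obtain ⟨O₁, hO₁, hzO₁, A, hA, hidem, hAD⟩ := hD.exists_projection x₀
  obtain ⟨O₂, hO₂, hzO₂, hO₂t, Γ, hΓ, hΓc⟩ := exists_contDiffOn_christoffel cov x₀
  have hO : IsOpen (O₁ ∩ O₂) := hO₁.inter hO₂
  have hts : t₀ ∈ s := Ico_subset_Icc_self ht₀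
  let φ := extChartAt 𝓘(ℝ, E) x₀
  let x : ℝ → E := fun t ↦ φ (c t)
  let v : ℝ → E := fun t ↦ fiberCoord x₀ ⟨c t, velocity c s t⟩
  have hgood : ∀ᶠ t in 𝓝[s] t₀, c t ∈ (chartAt E x₀).source ∧ x t ∈ O₁ ∩ O₂ :=
    ((hc.contMDiffOn.continuousOn t₀ hts).eventually
      ((chartAt E x₀).open_source.mem_nhds (mem_chart_source E x₀))).and
      ((hc.hasDerivWithinAt hs hts (mem_chart_source E x₀)).1.continuousWithinAt.eventually
        (hO.mem_nhds ⟨hzO₁, hzO₂⟩))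
  have hgood' : {t | c t ∈ (chartAt E x₀).source ∧ x t ∈ O₁ ∩ O₂} ∈ 𝓝[≥] t₀ := by
    refine nhdsWithin_le_of_mem ?_ hgood
    exact Icc_mem_nhdsGE_of_mem ht₀
  obtain ⟨t₁, ht₁, hsub⟩ := (mem_nhdsGE_iff_exists_Icc_subset).1 hgood'
  -- `t₁` keeps the geodesic in the region where both `A` and `Γ` are available, `y` is the
  -- prescribed bound, and `b` ends the domain.
  let t₂ := min t₁ (min y b)
  have ht₂ : t₀ < t₂ := lt_min ht₁ (lt_min hy ht₀.2)
  have hgood₂ : ∀ t ∈ Icc t₀ t₂, c t ∈ (chartAt E x₀).source ∧ x t ∈ O₁ ∩ O₂ := fun t ht ↦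
    hsub ⟨ht.1, ht.2.trans (min_le_left _ _)⟩
  have hss : Icc t₀ t₂ ⊆ s := Icc_subset_Icc ht₀.1 ((min_le_right _ _).trans (min_le_right _ _))
  have key := apply_eq_zero_of_geodesicEquation hO (hΓ.continuousOn.mono inter_subset_right)
    ((hA.of_le (by norm_cast)).mono inter_subset_left : ContDiffOn ℝ 1 A (O₁ ∩ O₂))
    (fun z hz ↦ hidem z hz.1) (fun z hz w hw ↦ ?_) (x := x) (v := v) (fun t ht ↦ (hgood₂ t ht).2)
    (fun t ht ↦ (hc.hasDerivWithinAt hs (hss ht) (hgood₂ t ht).1).1.mono hss)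
    (fun t ht ↦ ?_) ((hAD ⟨c t₀, velocity c s t₀⟩ (mem_chart_source E x₀) hzO₁).2 hD₀)
  · refine ⟨t₂, ⟨ht₂, (min_le_right _ _).trans (min_le_left _ _)⟩, ?_⟩
    have ht := right_mem_Icc.2 ht₂.le
    exact (hAD ⟨c t₂, velocity c s t₂⟩ (hgood₂ t₂ ht).1 (hgood₂ t₂ ht).2.1).1 (key t₂ ht)
  -- Any `(z, w)` with `A z w = 0` is the coordinate pair of a vector `q` of $D$; tangency at `q`
  -- gives the required identity.
  · have hzt := hO₂t hz.2
    have hys : φ.symm z ∈ (chartAt E x₀).source := by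
      have h := φ.map_target hzt
      rwa [extChartAt_source] at h
    have hφz : φ (φ.symm z) = z := φ.right_inv hzt
    let q : TangentBundle 𝓘(ℝ, E) M := ⟨φ.symm z, constField x₀ w (φ.symm z)⟩
    have hqw : fiberCoord x₀ q = w := fiberCoord_constField hys w
    have hqO : φ q.proj ∈ O₁ := by
      change φ (φ.symm z) ∈ O₁
      rw [hφz]; exact hz.1
    have hqS : q ∈ totalSet D := (hAD q hys hqO).1 (by
      change A (φ (φ.symm z)) (fiberCoord x₀ q) = 0
      rw [hφz, hqw, hw])
    have h := fderiv_apply_sub_eq_zero_of_mem_tangentVectors hO₁ hA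
      (fun v hv hvO hvS ↦ (hAD v hv hvO).2 hvS) (v := q) hys hqO (hZ q hqS)
    have hΓz := hΓc (φ.symm z) hys (by change φ (φ.symm z) ∈ O₂; rw [hφz]; exact hz.2) w w
    change fderiv ℝ A (φ (φ.symm z)) (fiberCoord x₀ q) (fiberCoord x₀ q) -
      A (φ (φ.symm z)) (christoffel cov x₀ (φ.symm z) (fiberCoord x₀ q) (fiberCoord x₀ q)) = 0 at h
    change Γ (φ (φ.symm z)) w w = _ at hΓz
    rwa [hqw, ← hΓz, hφz] at h
  · have h := (hc.hasDerivWithinAt hs (hss ht) (hgood₂ t ht).1).2.mono hss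
    rwa [← hΓc _ (hgood₂ t ht).1 (hgood₂ t ht).2.2] at h

/-- Continuous induction on $[a,b]$: the set of good times contains $a$, is closed, and has points
arbitrarily close to the right of each of its members below $b$. -/
theorem IsSmoothDistribution.geodesicallyInvariant [T2Space M]
    [CovariantDerivative.ContMDiffCovariantDerivative cov ∞] (hD : IsSmoothDistribution D p)
    (hZ : IsTangentTo (geodesicSpray cov) (totalSet D)) : GeodesicallyInvariant cov D := by
  intro a b c hab hc ha
  have hs : UniqueDiffOn ℝ (Icc a b) := uniqueDiffOn_Icc hab
  refine IsClosed.Icc_subset_of_forall_exists_gt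
    (s := {t | velocity c (Icc a b) t ∈ D (c t)}) ?_ ha fun t ht y hy ↦ ?_
  · refine isClosed_of_closure_subset fun t ht ↦ ?_
    have htI : t ∈ Icc a b := closure_minimal inter_subset_right isClosed_Icc ht
    exact ⟨hD.mem_of_mem_closure hs hc htI ht, htI⟩
  · obtain ⟨t', ht', h⟩ := hD.exists_gt_of_isTangentTo hZ hc ht.2 ht.1 hy
    exact ⟨t', h, ht'⟩

/-- Under geodesic invariance, a solution of the geodesic equation that starts in `D` stays in `D`
for positive times. -/
lemma GeodesicallyInvariant.constField_mem (hGI : GeodesicallyInvariant cov D) {x₀ : M} {O : Set E}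
    (hO : O ⊆ (extChartAt 𝓘(ℝ, E) x₀).target) {Γ : E → E →L[ℝ] E →L[ℝ] E}
    (hΓ : ∀ y ∈ (chartAt E x₀).source, extChartAt 𝓘(ℝ, E) x₀ y ∈ O → ∀ u w,
      Γ (extChartAt 𝓘(ℝ, E) x₀ y) u w = christoffel cov x₀ y u w)
    {ε : ℝ} {x v : ℝ → E} (hx : ContDiffOn ℝ ∞ x (Ioo (-ε) ε))
    (hsol : ∀ t ∈ Ioo (-ε) ε, x t ∈ O ∧ HasDerivAt x (v t) t ∧
      HasDerivAt v (-(Γ (x t) (v t) (v t))) t)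
    (h0 : constField x₀ (v 0) ((extChartAt 𝓘(ℝ, E) x₀).symm (x 0)) ∈
      D ((extChartAt 𝓘(ℝ, E) x₀).symm (x 0))) {t : ℝ} (ht : 0 ≤ t) (htε : t < ε) :
    constField x₀ (v t) ((extChartAt 𝓘(ℝ, E) x₀).symm (x t)) ∈
      D ((extChartAt 𝓘(ℝ, E) x₀).symm (x t)) := by
  -- `GeodesicallyInvariant` speaks only of intervals with $a<b$, so time 0 is treated apart.
  rcases ht.eq_or_lt with rfl | ht
  · exact h0
  have hsub : Icc 0 t ⊆ Ioo (-ε) ε := fun r hr ↦ ⟨by linarith [hr.1], by linarith [hr.2]⟩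
  obtain ⟨hgeo, hvel⟩ := isGeodesicOn_of_hasDerivAt hO hΓ (uniqueDiffOn_Icc ht) (hx.mono hsub)
    fun r hr ↦ hsol r (hsub hr)
  have h := hGI 0 t _ ht hgeo (by rwa [hvel 0 ⟨le_rfl, ht.le⟩]) t ⟨ht.le, le_rfl⟩
  rwa [hvel t ⟨ht.le, le_rfl⟩] at h

/-- The curve witnessing tangency at a vector is the velocity curve of the local geodesic with that
initial velocity. It has to lie in $D$ on both sides of 0, whereas invariance only looks forward. -/
theorem GeodesicallyInvariant.isTangentTo [T2Space M]
    [CovariantDerivative.ContMDiffCovariantDerivative cov ∞]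
    (hGI : GeodesicallyInvariant cov D) : IsTangentTo (geodesicSpray cov) (totalSet D) := by
  rintro ⟨x₀, u⟩ hu
  obtain ⟨O, hO, hzO, hOt, Γ, hΓ, hΓc⟩ := exists_contDiffOn_christoffel cov x₀
  let φ := extChartAt 𝓘(ℝ, E) x₀
  obtain ⟨ε, hε, x, v, hx0, hv0, hx, hv, hsol⟩ :=
    exists_geodesicEquation_solution hO hΓ hzO (fiberCoord x₀ ⟨x₀, u⟩)
  have hJ : UniqueDiffOn ℝ (Ioo (-ε) ε) := isOpen_Ioo.uniqueDiffOn
  have h0J : (0 : ℝ) ∈ Ioo (-ε) ε := ⟨by linarith, hε⟩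
  obtain ⟨hgeo, hvel⟩ := isGeodesicOn_of_hasDerivAt hOt hΓc hJ hx hsol
  set c : ℝ → M := fun t ↦ φ.symm (x t) with hcdef
  have hc0 : c 0 = x₀ := by
    change φ.symm (x 0) = x₀
    rw [hx0]
    exact extChartAt_to_inv x₀
  have hγ0 : (⟨c 0, velocity c (Ioo (-ε) ε) 0⟩ : TangentBundle 𝓘(ℝ, E) M) = ⟨x₀, u⟩ := by
    have h1 : (⟨c 0, velocity c (Ioo (-ε) ε) 0⟩ : TangentBundle 𝓘(ℝ, E) M) =
        ⟨c 0, constField x₀ (fiberCoord x₀ ⟨x₀, u⟩) (c 0)⟩ := by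
      rw [hvel 0 h0J, hv0]
    have h2 := constField_fiberCoord (mem_chart_source E x₀) u
    rw [h1, hc0, h2]
  have hmem0 : constField x₀ (v 0) (c 0) ∈ D (c 0) := by
    rw [← hvel 0 h0J]
    change (⟨c 0, velocity c (Ioo (-ε) ε) 0⟩ : TangentBundle 𝓘(ℝ, E) M) ∈ totalSet D
    rwa [hγ0]
  have hmem : ∀ t ∈ Ioo (-ε) ε, constField x₀ (v t) (c t) ∈ D (c t) := by
    intro t ht
    rcases le_total 0 t with h | h
    · exact hGI.constField_mem hOt hΓc hx hsol hmem0 h ht.2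
    -- For negative times, $r\mapsto(x(-r),-v(-r))$ solves the same equation because $\Gamma(v,v)$
    -- is even in $v$, and it starts in $D$ because subspaces are closed under negation.
    have hneg : ∀ r ∈ Ioo (-ε) ε, -r ∈ Ioo (-ε) ε := fun r hr ↦
      ⟨by linarith [hr.2], by linarith [hr.1]⟩
    have hcs : ∀ r ∈ Ioo (-ε) ε, c r ∈ (chartAt E x₀).source := fun r hr ↦ by
      have h := φ.map_target (hOt (hsol r hr).1)
      rwa [extChartAt_source] at h
    have hcneg : ∀ r ∈ Ioo (-ε) ε, constField x₀ (-v r) (c r) = -constField x₀ (v r) (c r) :=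
      fun r hr ↦ (constField_linear (hcs r hr)).map_neg (v r)
    -- `P (-0)` and `P (- -t)` say that the reversed solution lies in $D$ at times $0$ and $-t$.
    let P : ℝ → Prop := fun r ↦ constField x₀ (-v r) (c r) ∈ D (c r)
    have hP : ∀ r ∈ Ioo (-ε) ε, P r ↔ constField x₀ (v r) (c r) ∈ D (c r) := fun r hr ↦ by
      simp only [P, hcneg r hr, neg_mem_iff]
    have hP0 : P (-0) := by rwa [neg_zero, hP 0 h0J]
    have hPt : P (- -t) := hGI.constField_mem hOt hΓc (x := fun r ↦ x (-r)) (v := fun r ↦ -v (-r))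
      (hx.comp contDiff_neg.contDiffOn hneg) (fun r hr ↦ by
        obtain ⟨h1, h2, h3⟩ := hsol (-r) (hneg r hr)
        have h2' : HasDerivAt (fun r ↦ x (-r)) _ r := h2.scomp r (hasDerivAt_neg r)
        have h3' : HasDerivAt (fun r ↦ -v (-r)) _ r := (h3.scomp r (hasDerivAt_neg r)).neg
        exact ⟨h1, by simpa using h2', by simpa using h3'⟩) hP0 (neg_nonneg.2 h)
      (by linarith [ht.1])
    rwa [neg_neg, hP t ht] at hPt
  refine ⟨ε, fun t ↦ ⟨c t, velocity c (Ioo (-ε) ε) t⟩, hε, hγ0,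
    contMDiffOn_velocity hJ hgeo.contMDiffOn, fun t ht ↦ ?_, ?_⟩
  · change velocity c (Ioo (-ε) ε) t ∈ D (c t)
    rw [hvel t ht]
    exact hmem t ht
  · have h := hgeo.mfderivWithin_velocity hJ h0J
    rw [mfderivWithin_of_mem_nhds (Ioo_mem_nhds h0J.1 h0J.2)] at h
    exact h.trans (congrArg (fun q ↦ (geodesicSpray cov q : E × E)) hγ0)

end Main

end GeodesicInvariance

end

theorem mainTheorem8 {n : ℕ}
    {M : Type*} [TopologicalSpace M] [T2Space M] [ChartedSpace (EuclideanSpace ℝ (Fin n)) M]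
    [IsManifold (𝓡 n) ∞ M]
    (cov : CovariantDerivative (𝓡 n) (EuclideanSpace ℝ (Fin n))
      (TangentSpace (𝓡 n) : M → Type _))
    [CovariantDerivative.ContMDiffCovariantDerivative cov ∞]
    (p : ℕ) (D : (x : M) → Submodule ℝ (TangentSpace (𝓡 n) x))
    (hD : GeodesicInvariance.IsSmoothDistribution D p) :
    GeodesicInvariance.GeodesicallyInvariant cov D ↔
      GeodesicInvariance.IsTangentTo (GeodesicInvariance.geodesicSpray cov)
        (GeodesicInvariance.totalSet D) :=
  ⟨fun h ↦ h.isTangentTo, fun h ↦ hD.geodesicallyInvariant h⟩
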